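/- Let $\mathcal{A}$ be a complex unital associative algebra with product $m\colon\mathcal{A}\otimes\mathcal{A}\to\mathcal{A}$ and unit $1$, which is also a coassociative counital coalgebra with coproduct $\phi\colon\mathcal{A}\to\mathcal{A}\otimes\mathcal{A}$ and counit $\epsilon\colon\mathcal{A}\to\mathbb{C}$. Let $\kappa\colon\mathcal{A}\to\mathcal{A}$ and $\sigma\colon\mathcal{A}\otimes\mathcal{A}\to\mathcal{A}\otimes\mathcal{A}$ be bijective linear maps such that $(\mathcal{A},\{\phi,\epsilon,\kappa,\sigma\})$ is a braided quantum group, that is, \begin{align*} \sigma(m\otimes\mathrm{id})&=(\mathrm{id}\otimes m)(\sigma\otimes\mathrm{id})(\mathrm{id}\otimes\sigma),\\ \sigma(\mathrm{id}\otimes m)&=(m\otimes\mathrm{id})(\mathrm{id}\otimes\sigma)(\sigma\otimes\mathrm{id}),\\ \phi m&=(m\otimes m)(\mathrm{id}\otimes\sigma\otimes\mathrm{id})(\phi\otimes\phi),\\ (\sigma\otimes\mathrm{id}^2)(\mathrm{id}\otimes\phi\otimes\mathrm{id})(\sigma^{-1}\otimes\mathrm{id})(\mathrm{id}\otimes\phi)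 &=(\mathrm{id}^2\otimes\sigma)(\mathrm{id}\otimes\phi\otimes\mathrm{id})(\mathrm{id}\otimes\sigma^{-1})(\phi\otimes\mathrm{id}),\\ m(\mathrm{id}\otimes\kappa)\phi&=m(\kappa\otimes\mathrm{id})\phi=1\epsilon. \end{align*} Define $\tau\colon\mathcal{A}\otimes\mathcal{A}\to\mathcal{A}\otimes\mathcal{A}$ by $\tau=(\mathrm{id}^2\otimes\epsilon)(\mathrm{id}\otimes\sigma^{-1})(\phi\otimes\mathrm{id})\sigma$. Then the following eight identities of linear maps on $\mathcal{A}\otimes\mathcal{A}\otimes\mathcal{A}$ hold: \begin{align*} (\sigma\otimes\mathrm{id})(\mathrm{id}\otimes\sigma)(\sigma\otimes\mathrm{id})&=(\mathrm{id}\otimes\sigma)(\sigma\otimes\mathrm{id})(\mathrm{id}\otimes\sigma),\\ (\tau\otimes\mathrm{id})(\mathrm{id}\otimes\sigma)(\sigma\otimes\mathrm{id})&=(\mathrm{id}\otimes\sigma)(\sigma\otimes\mathrm{id})(\mathrm{id}\otimes\tau),\\ (\sigma\otimes\mathrm{id})(\mathrm{id}\otimes\tau)(\sigma\otimes\mathrm{id})&=(\mathrm{id}\otimes\sigma)(\tau\otimes\mathrm{id})(\mathrm{id}\otimes\sigma),\\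 (\sigma\otimes\mathrm{id})(\mathrm{id}\otimes\sigma)(\tau\otimes\mathrm{id})&=(\mathrm{id}\otimes\tau)(\sigma\otimes\mathrm{id})(\mathrm{id}\otimes\sigma),\\ (\tau\otimes\mathrm{id})(\mathrm{id}\otimes\tau)(\sigma\otimes\mathrm{id})&=(\mathrm{id}\otimes\sigma)(\tau\otimes\mathrm{id})(\mathrm{id}\otimes\tau),\\ (\tau\otimes\mathrm{id})(\mathrm{id}\otimes\sigma)(\tau\otimes\mathrm{id})&=(\mathrm{id}\otimes\tau)(\sigma\otimes\mathrm{id})(\mathrm{id}\otimes\tau),\\ (\sigma\otimes\mathrm{id})(\mathrm{id}\otimes\tau)(\tau\otimes\mathrm{id})&=(\mathrm{id}\otimes\tau)(\tau\otimes\mathrm{id})(\mathrm{id}\otimes\sigma),\\ (\tau\otimes\mathrm{id})(\mathrm{id}\otimes\tau)(\tau\otimes\mathrm{id})&=(\mathrm{id}\otimes\tau)(\tau\otimes\mathrm{id})(\mathrm{id}\otimes\tau). \end{align*} That is, $(\alpha\otimes\mathrm{id})(\mathrm{id}\otimes\beta)(\gamma\otimes\mathrm{id})=(\mathrm{id}\otimes\gamma)(\beta\otimes\mathrm{id})(\mathrm{id}\otimes\alpha)$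 for all $\alpha,\beta,\gamma\in\{\sigma,\tau\}$; in particular $\sigma$ and $\tau$ each satisfy the braid equation. -/

import Mathlib

open scoped TensorProduct

noncomputable section

namespace BraidedQG

variable {A : Type*} [Ring A] [Algebra ℂ A]

/-- For a linear map `f` of `A ⊗ A` and a complex vector space `M`, the map `f ⊗ id` of
`A ⊗ A ⊗ M`. Iterated tensor products are bracketed to the right throughout. -/
def tensorId (M : Type*) [AddCommGroup M] [Module ℂ M] (f : A ⊗[ℂ] A →ₗ[ℂ] A ⊗[ℂ] A) :
    A ⊗[ℂ] (A ⊗[ℂ] M) →ₗ[ℂ] A ⊗[ℂ] (A ⊗[ℂ] M) :=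
  (TensorProduct.assoc ℂ A A M).toLinearMap ∘ₗ f.rTensor M ∘ₗ
    (TensorProduct.assoc ℂ A A M).symm.toLinearMap

/-- For a linear map `f` of `A ⊗ A`, the map `id ⊗ f` of `A ⊗ A ⊗ A`. -/
def idTensor (f : A ⊗[ℂ] A →ₗ[ℂ] A ⊗[ℂ] A) :
    A ⊗[ℂ] (A ⊗[ℂ] A) →ₗ[ℂ] A ⊗[ℂ] (A ⊗[ℂ] A) :=
  f.lTensor A

/-- `m ⊗ id : A ⊗ A ⊗ A → A ⊗ A`, where `m` is the product of `A`. -/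
def mulTensorId : A ⊗[ℂ] (A ⊗[ℂ] A) →ₗ[ℂ] A ⊗[ℂ] A :=
  (LinearMap.mul' ℂ A).rTensor A ∘ₗ (TensorProduct.assoc ℂ A A A).symm.toLinearMap

/-- `id ⊗ m : A ⊗ A ⊗ A → A ⊗ A`, where `m` is the product of `A`. -/
def idTensorMul : A ⊗[ℂ] (A ⊗[ℂ] A) →ₗ[ℂ] A ⊗[ℂ] A :=
  (LinearMap.mul' ℂ A).lTensor A

/-- `id ⊗ f ⊗ id` on `(A ⊗ A) ⊗ (A ⊗ A)`, for a linear map `f` of `A ⊗ A`. -/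
def idTensorTensorId (f : A ⊗[ℂ] A →ₗ[ℂ] A ⊗[ℂ] A) :
    (A ⊗[ℂ] A) ⊗[ℂ] (A ⊗[ℂ] A) →ₗ[ℂ] (A ⊗[ℂ] A) ⊗[ℂ] (A ⊗[ℂ] A) :=
  (TensorProduct.assoc ℂ A A (A ⊗[ℂ] A)).symm.toLinearMap ∘ₗ
    (tensorId A f).lTensor A ∘ₗ
    (TensorProduct.assoc ℂ A A (A ⊗[ℂ] A)).toLinearMap

variable [Coalgebra ℂ A]

/-- `φ ⊗ id : A ⊗ A → A ⊗ A ⊗ A`, where `φ` is the coproduct of `A`. -/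
def comulTensorId : A ⊗[ℂ] A →ₗ[ℂ] A ⊗[ℂ] (A ⊗[ℂ] A) :=
  (TensorProduct.assoc ℂ A A A).toLinearMap ∘ₗ (Coalgebra.comul (R := ℂ) (A := A)).rTensor A

/-- `id ⊗ φ : A ⊗ A → A ⊗ A ⊗ A`, where `φ` is the coproduct of `A`. -/
def idTensorComul : A ⊗[ℂ] A →ₗ[ℂ] A ⊗[ℂ] (A ⊗[ℂ] A) :=
  (Coalgebra.comul (R := ℂ) (A := A)).lTensor A

/-- `id² ⊗ ε : A ⊗ A ⊗ A → A ⊗ A`, where `ε` is the counit of `A`. -/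
def idIdTensorCounit : A ⊗[ℂ] (A ⊗[ℂ] A) →ₗ[ℂ] A ⊗[ℂ] A :=
  ((TensorProduct.rid ℂ A).toLinearMap ∘ₗ (Coalgebra.counit (R := ℂ) (A := A)).lTensor A).lTensor A

end BraidedQG

open BraidedQG in
/-- A braided quantum group structure on a complex unital associative algebra `A` that is also
a coassociative counital coalgebra: a bijective antipode `κ` and a bijective flip-over operator
`σ`. No compatibility between the algebra and the coalgebra structure is assumed other than the
fields below. -/
structure BraidedQuantumGroup (A : Type*) [Ring A] [Algebra ℂ A] [Coalgebra ℂ A] where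
  /-- the antipode -/
  κ : A ≃ₗ[ℂ] A
  /-- the flip-over operator -/
  σ : A ⊗[ℂ] A ≃ₗ[ℂ] A ⊗[ℂ] A
  /-- `σ (m ⊗ id) = (id ⊗ m) (σ ⊗ id) (id ⊗ σ)` -/
  flip_mul_left : σ.toLinearMap ∘ₗ mulTensorId =
    idTensorMul ∘ₗ tensorId A σ.toLinearMap ∘ₗ idTensor σ.toLinearMap
  /-- `σ (id ⊗ m) = (m ⊗ id) (id ⊗ σ) (σ ⊗ id)` -/
  flip_mul_right : σ.toLinearMap ∘ₗ idTensorMul =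
    mulTensorId ∘ₗ idTensor σ.toLinearMap ∘ₗ tensorId A σ.toLinearMap
  /-- `φ m = (m ⊗ m) (id ⊗ σ ⊗ id) (φ ⊗ φ)` -/
  comul_mul : Coalgebra.comul (R := ℂ) (A := A) ∘ₗ LinearMap.mul' ℂ A =
    TensorProduct.map (LinearMap.mul' ℂ A) (LinearMap.mul' ℂ A) ∘ₗ
      idTensorTensorId σ.toLinearMap ∘ₗ
      TensorProduct.map (Coalgebra.comul (R := ℂ) (A := A)) (Coalgebra.comul (R := ℂ) (A := A))
  /-- `(σ ⊗ id²) (id ⊗ φ ⊗ id) (σ⁻¹ ⊗ id) (id ⊗ φ) =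
  (id² ⊗ σ) (id ⊗ φ ⊗ id) (id ⊗ σ⁻¹) (φ ⊗ id)` -/
  flip_comul :
    tensorId (A ⊗[ℂ] A) σ.toLinearMap ∘ₗ comulTensorId.lTensor A ∘ₗ
      tensorId A σ.symm.toLinearMap ∘ₗ idTensorComul =
    (idTensor σ.toLinearMap).lTensor A ∘ₗ comulTensorId.lTensor A ∘ₗ
      idTensor σ.symm.toLinearMap ∘ₗ comulTensorId
  /-- `m (id ⊗ κ) φ = 1 ε` -/
  mul_antipode_right :
    LinearMap.mul' ℂ A ∘ₗ κ.toLinearMap.lTensor A ∘ₗ Coalgebra.comul (R := ℂ) (A := A) =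
      Algebra.linearMap ℂ A ∘ₗ Coalgebra.counit (R := ℂ) (A := A)
  /-- `m (κ ⊗ id) φ = 1 ε` -/
  mul_antipode_left :
    LinearMap.mul' ℂ A ∘ₗ κ.toLinearMap.rTensor A ∘ₗ Coalgebra.comul (R := ℂ) (A := A) =
      Algebra.linearMap ℂ A ∘ₗ Coalgebra.counit (R := ℂ) (A := A)

/-- The secondary flip-over operator `τ = (id² ⊗ ε) (id ⊗ σ⁻¹) (φ ⊗ id) σ`. -/
def BraidedQuantumGroup.τ {A : Type*} [Ring A] [Algebra ℂ A] [Coalgebra ℂ A]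
    (G : BraidedQuantumGroup A) : A ⊗[ℂ] A →ₗ[ℂ] A ⊗[ℂ] A :=
  BraidedQG.idIdTensorCounit ∘ₗ BraidedQG.idTensor G.σ.symm.toLinearMap ∘ₗ
    BraidedQG.comulTensorId ∘ₗ G.σ.toLinearMap

end

/-! Let `a`, `b`, `c` be maps of `A ⊗ A` obeying the hexagon `g (id ⊗ m) = (m ⊗ id)(id ⊗ g)(g ⊗
id)`, with `(φ ⊗ id) c = (id ⊗ b)(a ⊗ id)(id ⊗ φ)`. Since `φ m` contains `σ`, expanding `(φ ⊗ id) c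
(id ⊗ m)` in two ways puts `σ` once before and once after the strand that crosses by `a` and `b`.
The outer products and coproducts cancel because the antipode inverts the canonical maps `x ⊗ y ↦ x
y₁ ⊗ y₂` and `x ⊗ y ↦ x₁ ⊗ x₂ y`. What is left is the braid identity for `σ`, `a`, `b` (`strand_s`).

The triples `(a, b, c)` needed are `(σ, σ, σ τ⁻¹ σ)`, `(σ, τ, σ)`, `(τ, σ, σ)` and `(τ, τ, τ)`.
Their coproduct laws (`p_s_V`, `p_s'`, `p_s`, `p_t`) rest on the fact that `R = σ⁻¹ τ` is invertible
and colinear on both sides. The four identities with `τ` in place of that `σ` follow from `τ = T σ`,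
as a strand passes through each constituent of `T` (`strand_T`).

To dispense with brackets and arities, all maps act on one space `M ≅ A ⊗ M`, so that each identity
equates two words in `End M`. `braid_of_crossing` returns to `A ⊗ A ⊗ A`. -/

/-! ### Words in the operators and commutation of distant letters -/

/-- The operators of a braided quantum group acting on the leading factors of an absorbing
space `M ≅ A ⊗ M`. The endomorphism `S` is `g ↦ id ⊗ g`. -/
structure BraidedCalculus (E : Type*) [Monoid E] where
  /-- `g ↦ id ⊗ g` -/
  S : E →* E
  /-- the flip-over operator -/
  s : E
  /-- the inverse of the flip-over operator -/
  si : E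
  /-- the product -/
  m : E
  /-- the coproduct -/
  p : E
  /-- the counit -/
  e : E
  /-- the antipode -/
  k : E
  /-- the unit -/
  u : E
  s_nat : ∀ h, s * S (S h) = S (S h) * s
  si_nat : ∀ h, si * S (S h) = S (S h) * si
  m_nat : ∀ h, m * S (S h) = S h * m
  p_nat : ∀ h, p * S h = S (S h) * p
  e_nat : ∀ h, e * S h = h * e
  k_nat : ∀ h, k * S h = S h * k
  u_nat : ∀ h, u * h = S h * u
  si_s : si * s = 1
  s_si : s * si = 1
  m_assoc : m * m = m * S m
  m_u : m * u = 1
  m_Su : m * S u = 1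
  p_coassoc : p * p = S p * p
  e_p : e * p = 1
  Se_p : S e * p = 1
  s_m : s * m = S m * s * S s
  s_Sm : s * S m = m * S s * s
  p_m : p * m = m * S (S m) * S s * p * S p
  s_p : s * S p * si * S p = S (S s) * S p * S si * p
  m_Sk_p : m * S k * p = u * e
  m_k_p : m * k * p = u * e

namespace BraidedCalculus

variable {E : Type*} [Monoid E] (C : BraidedCalculus E)

/-- The operator `g` acting on the factors from position `k` on. -/
def act (g : E) (k : ℕ) (w : E) : E := (C.S^[k] g) * w

theorem act_mul (a b : E) (k : ℕ) (w : E) : C.act (a * b) k w = C.act a k (C.act b k w) := by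
  simp [act, iterate_map_mul, mul_assoc]

theorem act_one (k : ℕ) (w : E) : C.act 1 k w = w := by
  simp [act, iterate_map_one]

theorem act_S (a : E) (k : ℕ) (w : E) : C.act (C.S a) k w = C.act a (k+1) w := by
  simp [act]

/-- An operator that turns `i` factors into `j` factors commutes with everything to its right, up to
the resulting change of position. -/
theorem iterate_comm {i j : ℕ} {g : E} (hg : ∀ h, g * C.S^[i] h = C.S^[j] h * g) (k n : ℕ) (h : E)
    (w : E) : C.act g k (C.act h (k + i + n) w) = C.act h (k + j + n) (C.act g k w) := by
  simp only [act, ← mul_assoc]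
  have := congrArg (C.S^[k]) (hg (C.S^[n] h))
  simp only [iterate_map_mul, ← Function.iterate_add_apply, ← add_assoc] at this
  rw [this]

theorem s_far {k a : ℕ} (h w : E) (hk : k + 2 ≤ a) :
    C.act C.s k (C.act h a w) = C.act h a (C.act C.s k w) := by
  obtain ⟨n, rfl⟩ := Nat.exists_eq_add_of_le hk
  exact C.iterate_comm (i := 2) (j := 2) C.s_nat k n h w

theorem si_far {k a : ℕ} (h w : E) (hk : k + 2 ≤ a) :
    C.act C.si k (C.act h a w) = C.act h a (C.act C.si k w) := by
  obtain ⟨n, rfl⟩ := Nat.exists_eq_add_of_le hk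
  exact C.iterate_comm (i := 2) (j := 2) C.si_nat k n h w

theorem m_far {k a : ℕ} (h w : E) (hk : k + 2 ≤ a) :
    C.act C.m k (C.act h a w) = C.act h (a - 1) (C.act C.m k w) := by
  obtain ⟨n, rfl⟩ := Nat.exists_eq_add_of_le hk
  rw [C.iterate_comm (i := 2) (j := 1) C.m_nat k n h w, show k + 2 + n - 1 = k + 1 + n by omega]

theorem p_far {k a : ℕ} (h w : E) (hk : k + 1 ≤ a) :
    C.act C.p k (C.act h a w) = C.act h (a + 1) (C.act C.p k w) := by
  obtain ⟨n, rfl⟩ := Nat.exists_eq_add_of_le hk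
  rw [C.iterate_comm (i := 1) (j := 2) C.p_nat k n h w, show k + 1 + n + 1 = k + 2 + n by omega]

theorem e_far {k a : ℕ} (h w : E) (hk : k + 1 ≤ a) :
    C.act C.e k (C.act h a w) = C.act h (a - 1) (C.act C.e k w) := by
  obtain ⟨n, rfl⟩ := Nat.exists_eq_add_of_le hk
  rw [C.iterate_comm (i := 1) (j := 0) C.e_nat k n h w, show k + 1 + n - 1 = k + n by omega]
  simp

theorem k_far {k a : ℕ} (h w : E) (hk : k + 1 ≤ a) :
    C.act C.k k (C.act h a w) = C.act h a (C.act C.k k w) := by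
  obtain ⟨n, rfl⟩ := Nat.exists_eq_add_of_le hk
  exact C.iterate_comm (i := 1) (j := 1) C.k_nat k n h w

theorem u_far {k a : ℕ} (h w : E) (hk : k ≤ a) :
    C.act C.u k (C.act h a w) = C.act h (a + 1) (C.act C.u k w) := by
  obtain ⟨n, rfl⟩ := Nat.exists_eq_add_of_le hk
  have := C.iterate_comm (i := 0) (j := 1) C.u_nat k n h w
  rwa [show k + 1 + n = k + n + 1 by omega] at this

theorem lift {a b : E} (h : a = b) (k : ℕ) (w : E) : C.act a k w = C.act b k w := by rw [h]

theorem ext {a b : E} (h : ∀ w, C.act a 0 w = C.act b 0 w) : a = b := by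
  simpa [act] using h 1

-- Each commutation is oriented so that the operator at the higher position is applied later; `simp`
-- then compares words up to such commutations.
attribute [local simp] act_mul act_S act_one s_far si_far m_far p_far e_far k_far u_far

local notation "𝐬" => C.act C.s
local notation "𝐫" => C.act C.si
local notation "𝐦" => C.act C.m
local notation "𝐩" => C.act C.p
local notation "𝐞" => C.act C.e
local notation "𝐤" => C.act C.k
local notation "𝐮" => C.act C.u

/-! ### Canonical maps and the functional `ε m` -/

/-- In Sweedler notation the composite is `x ⊗ y ↦ x y₁ κ(y₂) ⊗ y₃`, which the antipode contracts.
The next three lemmas are variants. -/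
theorem right_can_left_inv : (C.m * C.S C.k * C.S C.p) * (C.m * C.S C.p) = 1 := by
  refine C.ext fun w => ?_
  have h1 := C.lift C.p_coassoc 1
  have h2 := C.lift C.m_Sk_p 1
  have h3 := C.lift C.m_assoc 0
  have h4 := C.lift C.m_Su 0
  have h5 := C.lift C.e_p 1
  simp only [act_mul, act_S, act_one] at *
  calc _ = 𝐦 0 (𝐦 0 (𝐤 2 (𝐩 2 (𝐩 1 w)))) := by simp
    _ = w := by rw [← h1, h3, h2, h5, h4]

theorem right_can_right_inv : (C.m * C.S C.p) * (C.m * C.S C.k * C.S C.p) = 1 := by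
  refine C.ext fun w => ?_
  have h1 := C.lift C.p_coassoc 1
  have h2 := C.lift C.m_k_p 1
  have h3 := C.lift C.m_assoc 0
  have h4 := C.lift C.m_Su 0
  have h5 := C.lift C.e_p 1
  simp only [act_mul, act_S, act_one] at *
  calc _ = 𝐦 0 (𝐦 0 (𝐤 1 (𝐩 2 (𝐩 1 w)))) := by simp
    _ = w := by rw [← h1, h3, h2, h5, h4]

theorem left_can_left_inv : (C.S C.m * C.S C.k * C.p) * (C.S C.m * C.p) = 1 := by
  refine C.ext fun w => ?_
  have h1 := C.lift C.p_coassoc 0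
  have h2 := C.lift C.m_k_p 1
  have h3 := C.lift C.m_assoc 1
  have h4 := C.lift C.m_u 1
  have h5 := C.lift C.Se_p 0
  simp only [act_mul, act_S, act_one] at *
  calc _ = 𝐦 1 (𝐦 2 (𝐤 1 (𝐩 0 (𝐩 0 w)))) := by simp
    _ = w := by rw [h1, ← h3, h2, h5, h4]

theorem left_can_right_inv : (C.S C.m * C.p) * (C.S C.m * C.S C.k * C.p) = 1 := by
  refine C.ext fun w => ?_
  have h1 := C.lift C.p_coassoc 0
  have h2 := C.lift C.m_Sk_p 1
  have h3 := C.lift C.m_assoc 1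
  have h4 := C.lift C.m_u 1
  have h5 := C.lift C.Se_p 0
  simp only [act_mul, act_S, act_one] at *
  calc _ = 𝐦 1 (𝐦 2 (𝐤 2 (𝐩 0 (𝐩 0 w)))) := by simp
    _ = w := by rw [h1, ← h3, h2, h5, h4]

/-- Write `X` for the left side. The counit on the first leg of `φ m` gives `X(x ⊗ y₁) y₂ = x y`.
Replacing `y` by `y₁` and multiplying on the right by `κ(y₂)` removes the extra factor. -/
theorem q_s_p : C.e * C.m * C.S C.s * C.p = C.S C.e := by
  have h1 := C.lift C.p_coassoc 1
  have h2 := C.lift C.m_Sk_p 1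
  have h2' := C.lift C.m_Sk_p 2
  have h3 := C.lift C.m_assoc 0
  have h4 := C.lift C.m_Su 0
  have h5 := C.lift C.Se_p 1
  have h6 := C.lift C.p_m 0
  have h7 := C.lift C.e_p 0
  simp only [act_mul, act_S, act_one] at *
  have key (w) : 𝐦 0 (𝐞 0 (𝐦 0 (𝐬 1 (𝐩 0 (𝐩 1 w))))) = 𝐦 0 w := by
    rw [← h7 (𝐦 0 w), h6]
    simp
  refine C.ext fun w => ?_
  symm
  calc _ = 𝐞 1 w := by simp
    _ = 𝐦 0 (𝐦 0 (𝐤 2 (𝐩 1 w))) := by rw [h3, h2, h4]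
    _ = 𝐦 0 (𝐤 1 (𝐦 0 (𝐩 1 w))) := by simp
    _ = 𝐦 0 (𝐤 1 (𝐦 0 (𝐞 0 (𝐦 0 (𝐬 1 (𝐩 0 (𝐩 1 (𝐩 1 w)))))))) := by rw [key]
    _ = 𝐦 0 (𝐦 0 (𝐞 0 (𝐦 0 (𝐬 1 (𝐩 0 (𝐤 3 (𝐩 2 (𝐩 1 w)))))))) := by rw [h1]; simp
    _ = 𝐦 0 (𝐞 0 (𝐦 0 (𝐬 1 (𝐩 0 (𝐦 2 (𝐤 3 (𝐩 2 (𝐩 1 w)))))))) := by rw [h3]; simp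
    _ = 𝐦 0 (𝐮 1 (𝐞 0 (𝐦 0 (𝐬 1 (𝐩 0 (𝐞 2 (𝐩 1 w))))))) := by rw [h2']; simp
    _ = _ := by rw [h4, h5]; simp

/-- Mirror image of `q_s_p`: the counit is put on the second leg of `φ m`, and the other antipode
axiom is used. -/
theorem Sq_s_Sp : C.S C.e * C.S C.m * C.s * C.S C.p = C.e := by
  have h1 := C.lift C.p_coassoc 0
  have h2 := C.lift C.m_k_p 0
  have h3 := C.lift C.m_assoc 0
  have h4 := C.lift C.m_u 0
  have h5 := C.lift C.e_p 0
  have h6 := C.lift C.p_m 0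
  have h7 := C.lift C.Se_p 0
  simp only [act_mul, act_S, act_one] at *
  have key := C.lift (show C.m * C.S (C.S C.e * C.S C.m * C.s * C.S C.p) * C.p = C.m by
    refine C.ext fun w => ?_
    rw [← h7 (𝐦 0 w), h6]
    simp) 1
  simp only [act_mul, act_S] at key
  refine C.ext fun w => ?_
  symm
  calc _ = 𝐞 0 w := by simp
    _ = 𝐦 0 (𝐦 0 (𝐤 0 (𝐩 0 w))) := by rw [h2, h4]
    _ = 𝐦 0 (𝐤 0 (𝐦 1 (𝐩 0 w))) := by rw [h3]; simp
    _ = 𝐦 0 (𝐤 0 (𝐦 1 (𝐞 3 (𝐦 3 (𝐬 2 (𝐩 3 (𝐩 0 (𝐩 0 w)))))))) := by rw [← key, h1]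
    _ = 𝐦 0 (𝐦 1 (𝐞 3 (𝐦 3 (𝐬 2 (𝐩 3 (𝐤 0 (𝐩 0 (𝐩 0 w)))))))) := by simp
    _ = 𝐦 0 (𝐞 2 (𝐦 2 (𝐬 1 (𝐩 2 (𝐦 0 (𝐤 0 (𝐩 0 (𝐩 0 w)))))))) := by rw [← h3]; simp
    _ = 𝐦 0 (𝐞 2 (𝐦 2 (𝐬 1 (𝐩 2 (𝐮 0 w))))) := by rw [h2, h5]
    _ = 𝐦 0 (𝐮 0 (𝐞 1 (𝐦 1 (𝐬 0 (𝐩 1 w))))) := by simp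
    _ = _ := by rw [h4]; simp

/-! ### Consequences of the compatibility of `σ` with the coproduct -/

theorem act_s_si (k : ℕ) (w : E) : 𝐬 k (𝐫 k w) = w := by
  simpa using C.lift C.s_si k w

theorem act_si_s (k : ℕ) (w : E) : 𝐫 k (𝐬 k w) = w := by
  simpa using C.lift C.si_s k w

theorem act_e_p (k : ℕ) (w : E) : 𝐞 k (𝐩 k w) = w := by
  simpa using C.lift C.e_p k w

theorem act_Se_p (k : ℕ) (w : E) : 𝐞 (k + 1) (𝐩 k w) = w := by
  simpa using C.lift C.Se_p k w

theorem act_p_p (k : ℕ) (w : E) : 𝐩 k (𝐩 k w) = 𝐩 (k + 1) (𝐩 k w) := by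
  simpa using C.lift C.p_coassoc k w

theorem act_s_p (k : ℕ) (w : E) : 𝐬 k (𝐩 (k + 1) (𝐫 k (𝐩 (k + 1) w))) =
    𝐬 (k + 2) (𝐩 (k + 1) (𝐫 (k + 1) (𝐩 k w))) := by
  simpa using C.lift C.s_p k w

theorem act_q_s_p (k : ℕ) (w : E) : 𝐞 k (𝐦 k (𝐬 (k + 1) (𝐩 k w))) = 𝐞 (k + 1) w := by
  simpa using C.lift C.q_s_p k w

theorem act_Sq_s_Sp (k : ℕ) (w : E) :
    𝐞 (k + 1) (𝐦 (k + 1) (𝐬 k (𝐩 (k + 1) w))) = 𝐞 k w := by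
  simpa using C.lift C.Sq_s_Sp k w

theorem p_si_p (w : E) : 𝐩 1 (𝐫 0 (𝐩 1 w)) = 𝐬 2 (𝐫 0 (𝐩 1 (𝐫 1 (𝐩 0 w)))) := by
  rw [← C.act_si_s 0 (𝐩 1 (𝐫 0 (𝐩 1 w))), C.act_s_p 0]
  simp

theorem p_si_p' (w : E) : 𝐩 1 (𝐫 1 (𝐩 0 w)) = 𝐬 0 (𝐫 2 (𝐩 1 (𝐫 0 (𝐩 1 w)))) := by
  rw [← C.act_si_s 2 (𝐩 1 (𝐫 1 (𝐩 0 w))), ← C.act_s_p 0]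
  simp

/-- Obtained from `s_p` used repeatedly around coassociativity; the counit then deletes an auxiliary
leg. It serves twice: under a counit it identifies `σ⁻¹τ` in `p_R_eq`, and in full it gives the
colinearity `p_R`. -/
theorem m_s_p_si_y (w : E) : 𝐦 0 (𝐬 1 (𝐩 0 (𝐫 0 (𝐫 1 (𝐩 0 (𝐬 0 w)))))) =
    𝐦 0 (𝐫 2 (𝐩 1 (𝐬 1 (𝐩 0 w)))) := by
  have key (v : E) : 𝐬 2 (𝐦 1 (𝐬 2 (𝐩 1 (𝐫 1 (𝐫 2 (𝐩 1 (𝐩 0 v))))))) =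
      𝐦 1 (𝐩 2 (𝐬 2 (𝐩 1 (𝐫 1 (𝐩 0 v))))) := by
    rw [← C.act_s_p 0]
    symm
    calc _ = 𝐦 1 (𝐬 0 (𝐩 2 (𝐩 1 (𝐫 0 (𝐩 1 v))))) := by simp
      _ = 𝐦 1 (𝐬 0 (𝐩 1 (𝐬 2 (𝐫 0 (𝐩 1 (𝐫 1 (𝐩 0 v))))))) := by
        rw [← C.act_p_p 1, p_si_p]
      _ = 𝐬 2 (𝐦 1 (𝐬 0 (𝐩 1 (𝐫 0 (𝐩 1 (𝐫 1 (𝐩 0 v))))))) := by simp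
      _ = 𝐬 2 (𝐦 1 (𝐬 2 (𝐩 1 (𝐫 1 (𝐩 0 (𝐫 1 (𝐩 0 v))))))) := by rw [C.act_s_p 0]
      _ = 𝐬 2 (𝐦 1 (𝐬 2 (𝐩 1 (𝐫 1 (𝐫 2 (𝐩 0 (𝐩 0 v))))))) := by simp
      _ = _ := by rw [C.act_p_p 0]
  have h := congrArg (fun v => 𝐞 0 (𝐫 2 v)) (key (𝐬 0 w))
  simp only [act_si_s] at h
  calc _ = 𝐦 0 (𝐬 1 (𝐩 0 (𝐫 0 (𝐫 1 (𝐩 0 (𝐞 0 (𝐩 0 (𝐬 0 w)))))))) := by rw [act_e_p]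
    _ = 𝐞 0 (𝐦 1 (𝐬 2 (𝐩 1 (𝐫 1 (𝐫 2 (𝐩 1 (𝐩 0 (𝐬 0 w)))))))) := by simp
    _ = 𝐞 0 (𝐫 2 (𝐦 1 (𝐩 2 (𝐬 2 (𝐩 1 (𝐫 1 (𝐩 0 (𝐬 0 w)))))))) := h
    _ = 𝐦 0 (𝐫 2 (𝐩 1 (𝐬 1 (𝐩 0 (𝐫 0 (𝐞 0 (𝐩 0 (𝐬 0 w)))))))) := by simp
    _ = _ := by rw [act_e_p, act_si_s]

theorem m_s_p_si_x (w : E) : 𝐦 2 (𝐬 1 (𝐩 2 (𝐫 1 (𝐫 0 (𝐩 1 (𝐬 0 w)))))) =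
    𝐦 2 (𝐫 0 (𝐩 1 (𝐬 0 (𝐩 1 w)))) := by
  have key (v : E) : 𝐬 0 (𝐦 2 (𝐬 1 (𝐩 2 (𝐫 1 (𝐫 0 (𝐩 1 (𝐩 1 v))))))) =
      𝐦 2 (𝐩 1 (𝐬 0 (𝐩 1 (𝐫 0 (𝐩 1 v))))) := by
    rw [C.act_s_p 0]
    symm
    calc _ = 𝐦 2 (𝐬 3 (𝐩 1 (𝐩 1 (𝐫 1 (𝐩 0 v))))) := by simp
      _ = 𝐦 2 (𝐬 3 (𝐩 2 (𝐬 0 (𝐫 2 (𝐩 1 (𝐫 0 (𝐩 1 v))))))) := by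
        rw [C.act_p_p 1, p_si_p']
      _ = 𝐬 0 (𝐦 2 (𝐬 3 (𝐩 2 (𝐫 2 (𝐩 1 (𝐫 0 (𝐩 1 v))))))) := by simp
      _ = 𝐬 0 (𝐦 2 (𝐬 1 (𝐩 2 (𝐫 1 (𝐩 2 (𝐫 0 (𝐩 1 v))))))) := by rw [C.act_s_p 1]
      _ = 𝐬 0 (𝐦 2 (𝐬 1 (𝐩 2 (𝐫 1 (𝐫 0 (𝐩 2 (𝐩 1 v))))))) := by simp
      _ = _ := by rw [← C.act_p_p 1]
  have h := congrArg (fun v => 𝐞 3 (𝐫 0 v)) (key (𝐬 0 w))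
  simp only [act_si_s] at h
  calc _ = 𝐦 2 (𝐬 1 (𝐩 2 (𝐫 1 (𝐫 0 (𝐩 1 (𝐞 2 (𝐩 1 (𝐬 0 w)))))))) := by rw [C.act_Se_p 1]
    _ = 𝐞 3 (𝐦 2 (𝐬 1 (𝐩 2 (𝐫 1 (𝐫 0 (𝐩 1 (𝐩 1 (𝐬 0 w)))))))) := by simp
    _ = 𝐞 3 (𝐫 0 (𝐦 2 (𝐩 1 (𝐬 0 (𝐩 1 (𝐫 0 (𝐩 1 (𝐬 0 w)))))))) := h
    _ = 𝐦 2 (𝐫 0 (𝐩 1 (𝐬 0 (𝐩 1 (𝐫 0 (𝐞 2 (𝐩 1 (𝐬 0 w)))))))) := by simp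
    _ = _ := by rw [C.act_Se_p 1, act_si_s]

/-! ### The operator `τ` and the colinearity of `σ⁻¹ τ` -/

/-- `(id² ⊗ ε) (id ⊗ σ⁻¹) (φ ⊗ id)` -/
def T : E := C.S (C.S C.e) * C.S C.si * C.p

/-- The secondary flip-over operator. -/
def t : E := C.T * C.s

/-- `σ⁻¹ τ` -/
def R : E := C.si * C.t

local notation "𝐓" => C.act C.T
local notation "𝐭" => C.act C.t
local notation "𝐑" => C.act C.R

theorem act_T (k : ℕ) (w : E) : 𝐓 k w = 𝐞 (k + 2) (𝐫 (k + 1) (𝐩 k w)) := by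
  simp [T]

/-- Apply `ε m` to the two middle legs of `s_p`: one side collapses by `Sq_s_Sp`, the other by
`q_s_p`. The original form of `T` shows colinearity on the left, this one on the right. -/
theorem act_T' (k : ℕ) (w : E) : 𝐓 k w = 𝐞 k (𝐫 k (𝐩 (k + 1) w)) := by
  have : C.T = C.e * C.si * C.S C.p := C.ext fun w => by
    have h := congrArg (fun v => 𝐞 1 (𝐦 1 v)) (C.act_s_p 0 w)
    have h1 := C.act_Sq_s_Sp 0
    have h2 := C.act_q_s_p 1
    simp only [zero_add, Nat.reduceAdd] at h h1 h2
    rw [h1, h2] at h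
    simp [act_T, h]
  rw [this]
  simp

theorem act_t (k : ℕ) (w : E) : 𝐭 k w = 𝐓 k (𝐬 k w) := by simp [t]

theorem act_R (k : ℕ) (w : E) : 𝐑 k w = 𝐫 k (𝐭 k w) := by simp [R]

theorem act_s_R (k : ℕ) (w : E) : 𝐬 k (𝐑 k w) = 𝐭 k w := by rw [act_R, act_s_si]

theorem T_far {k a : ℕ} (h w : E) (hk : k + 2 ≤ a) :
    𝐓 k (C.act h a w) = C.act h a (𝐓 k w) := by
  rw [act_T, act_T, p_far, si_far, e_far, Nat.add_sub_cancel] <;> omega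

theorem t_far {k a : ℕ} (h w : E) (hk : k + 2 ≤ a) :
    𝐭 k (C.act h a w) = C.act h a (𝐭 k w) := by
  rw [act_t, act_t, s_far, T_far] <;> omega

theorem R_far {k a : ℕ} (h w : E) (hk : k + 2 ≤ a) :
    𝐑 k (C.act h a w) = C.act h a (𝐑 k w) := by
  rw [act_R, act_R, t_far, si_far] <;> omega

attribute [local simp] T_far t_far R_far

theorem p_T : C.p * C.T = C.S C.T * C.p := C.ext fun w => by
  have := C.act_p_p 0 w
  simp_all [act_T]

theorem Sp_T : C.S C.p * C.T = C.T * C.S C.p := C.ext fun w => by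
  have := C.act_p_p 1 w
  simp_all [act_T']

theorem act_p_T (k : ℕ) (w : E) : 𝐩 k (𝐓 k w) = 𝐓 (k + 1) (𝐩 k w) := by
  simpa using C.lift C.p_T k w

theorem act_Sp_T (k : ℕ) (w : E) : 𝐩 (k + 1) (𝐓 k w) = 𝐓 k (𝐩 (k + 1) w) := by
  simpa using C.lift C.Sp_T k w

theorem e_T (w : E) : 𝐞 0 (𝐓 0 w) = 𝐞 1 (𝐫 0 w) := by
  calc _ = 𝐞 1 (𝐫 0 (𝐞 0 (𝐩 0 w))) := by simp [act_T]
    _ = _ := by rw [act_e_p]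

theorem Se_T (w : E) : 𝐞 1 (𝐓 0 w) = 𝐞 0 (𝐫 0 w) := by
  calc _ = 𝐞 0 (𝐫 0 (𝐞 2 (𝐩 1 w))) := by simp [act_T']
    _ = _ := by rw [C.act_Se_p 1]

theorem e_t (w : E) : 𝐞 0 (𝐭 0 w) = 𝐞 1 w := by rw [act_t, e_T, act_si_s]

theorem Se_t (w : E) : 𝐞 1 (𝐭 0 w) = 𝐞 0 w := by rw [act_t, Se_T, act_si_s]

/-- A formula for `τ` free of `σ⁻¹`: after `φ` is applied to `T`, the compatibility `s_p` and
`Sq_s_Sp` introduce `σ`, and the counit undoes `φ`. -/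
theorem t_eq_q_p_s_p (w : E) : 𝐭 0 w = 𝐞 0 (𝐦 0 (𝐩 1 (𝐬 1 (𝐩 0 w)))) := by
  have key (v : E) : 𝐩 0 (𝐓 0 v) = 𝐞 1 (𝐦 1 (𝐩 2 (𝐬 2 (𝐩 1 (𝐫 1 (𝐩 0 v)))))) := by
    rw [← C.act_s_p 0]
    symm
    calc _ = 𝐞 1 (𝐦 1 (𝐬 0 (𝐩 2 (𝐩 1 (𝐫 0 (𝐩 1 v)))))) := by simp
      _ = 𝐞 0 (𝐩 1 (𝐫 0 (𝐩 1 v))) := by rw [← C.act_p_p 1, C.act_Sq_s_Sp 0]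
      _ = _ := by simp [act_T']
  have h := congrArg (𝐞 0) (key (𝐬 0 w))
  rw [act_e_p] at h
  rw [act_t, h]
  calc _ = 𝐞 0 (𝐦 0 (𝐩 1 (𝐬 1 (𝐩 0 (𝐫 0 (𝐞 0 (𝐩 0 (𝐬 0 w)))))))) := by simp
    _ = _ := by rw [act_e_p, act_si_s]

theorem t_eq_Sq_p_s_p (w : E) : 𝐭 0 w = 𝐞 2 (𝐦 2 (𝐩 1 (𝐬 0 (𝐩 1 w)))) := by
  have key (v : E) : 𝐩 1 (𝐓 0 v) = 𝐞 2 (𝐦 2 (𝐩 1 (𝐬 0 (𝐩 1 (𝐫 0 (𝐩 1 v)))))) := by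
    rw [C.act_s_p 0]
    symm
    calc _ = 𝐞 2 (𝐦 2 (𝐬 3 (𝐩 1 (𝐩 1 (𝐫 1 (𝐩 0 v)))))) := by simp
      _ = 𝐞 3 (𝐩 1 (𝐫 1 (𝐩 0 v))) := by rw [C.act_p_p 1, C.act_q_s_p 2]
      _ = _ := by simp [act_T]
  have h := congrArg (𝐞 2) (key (𝐬 0 w))
  rw [C.act_Se_p 1] at h
  rw [act_t, h]
  calc _ = 𝐞 2 (𝐦 2 (𝐩 1 (𝐬 0 (𝐩 1 (𝐫 0 (𝐞 2 (𝐩 1 (𝐬 0 w)))))))) := by simp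
    _ = _ := by rw [C.act_Se_p 1, act_si_s]

/-- Call the right side `Y`. Applying `φ` to its second or to its third leg gives the same result
(`hpp`), so `Y` is `id ⊗ φ` of its contraction by `ε` in the second leg. That contraction is `R` by
`m_s_p_si_y` (`he`). -/
theorem p_R_eq (w : E) : 𝐩 1 (𝐑 0 w) = 𝐫 0 (𝐫 1 (𝐩 0 (𝐬 0 w))) := by
  have hu : C.p * (C.e * C.si) = C.S (C.e * C.si) * C.p := C.ext fun w => by
    have h := congrArg (𝐞 2) (C.act_p_T 0 w)
    have h1 := C.lift (C.ext (a := C.S C.e * C.T) (b := C.e * C.si) fun w => by simpa using C.Se_T w) 1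
    have h2 := C.Se_T w
    simp at h h1 h2 ⊢
    rw [← h1, ← h, ← h2]
    simp
  have hu2 := C.lift hu 2
  simp only [act_mul, act_S, Nat.reduceAdd] at hu2
  have hz (v : E) : 𝐫 0 (𝐫 1 (𝐩 0 v)) = 𝐞 2 (𝐫 2 (𝐩 1 (𝐫 0 (𝐩 1 v)))) := by
    rw [p_si_p, act_si_s]
    calc _ = 𝐫 0 (𝐞 2 (𝐩 1 (𝐫 1 (𝐩 0 v)))) := by rw [C.act_Se_p 1]
      _ = _ := by simp
  have hpp (v : E) : 𝐩 2 (𝐫 0 (𝐫 1 (𝐩 0 v))) = 𝐩 1 (𝐫 0 (𝐫 1 (𝐩 0 v))) := by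
    rw [hz, hu2, ← C.act_p_p 1]
    simp
  have he : 𝐞 1 (𝐫 0 (𝐫 1 (𝐩 0 (𝐬 0 w)))) = 𝐑 0 w := by
    have h := congrArg (𝐞 0) (C.m_s_p_si_y w)
    rw [C.act_q_s_p 0] at h
    rw [h, act_R, t_eq_q_p_s_p]
    simp
  have := congrArg (𝐞 1) (hpp (𝐬 0 w))
  rw [act_e_p] at this
  rw [← this, ← he]
  simp

theorem p_R_eq' (w : E) : 𝐩 0 (𝐑 0 w) = 𝐫 1 (𝐫 0 (𝐩 1 (𝐬 0 w))) := by
  have hu (w : E) : 𝐩 0 (𝐞 1 (𝐫 0 w)) = 𝐞 1 (𝐫 0 (𝐩 1 w)) := by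
    rw [← e_T, ← e_T, ← C.act_Sp_T 0 w]
    simp
  have hz (v : E) : 𝐫 1 (𝐫 0 (𝐩 1 v)) = 𝐞 1 (𝐫 0 (𝐩 1 (𝐫 1 (𝐩 0 v)))) := by
    rw [p_si_p', act_si_s]
    calc _ = 𝐫 1 (𝐞 1 (𝐩 1 (𝐫 0 (𝐩 1 v)))) := by rw [C.act_e_p 1]
      _ = _ := by simp
  have hpp (v : E) : 𝐩 0 (𝐫 1 (𝐫 0 (𝐩 1 v))) = 𝐩 1 (𝐫 1 (𝐫 0 (𝐩 1 v))) := by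
    rw [hz, hu, C.act_p_p 1]
    simp
  have he : 𝐞 1 (𝐫 1 (𝐫 0 (𝐩 1 (𝐬 0 w)))) = 𝐑 0 w := by
    have h := congrArg (𝐞 2) (C.m_s_p_si_x w)
    rw [C.act_Sq_s_Sp 1] at h
    rw [h, act_R, t_eq_Sq_p_s_p]
    simp
  have := congrArg (𝐞 2) (hpp (𝐬 0 w))
  rw [C.act_Se_p 1] at this
  rw [← this, ← he]
  simp

/-- With `p_R_eq` inserted on both sides, `m_s_p_si_y` becomes the claim composed with `σ⁻¹` and a
canonical map, both of which are injective. -/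
theorem p_R : C.p * C.R = C.S C.R * C.p := C.ext fun w => by
  have hm (v : E) : 𝐦 0 (𝐬 1 v) = 𝐬 0 (𝐦 1 (𝐫 0 v)) := by
    have := C.lift C.s_Sm 0 (𝐫 0 v)
    simp only [act_mul, act_S, zero_add, act_s_si] at this
    exact this.symm
  have hc (v : E) : 𝐦 1 (𝐤 2 (𝐩 2 (𝐦 1 (𝐩 2 v)))) = v := by
    simpa only [act_mul, act_S, act_one] using C.lift C.right_can_left_inv 1 v
  have hR : C.S (C.S C.p) * C.S C.R = C.S (C.si * C.S C.si * C.p * C.s) :=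
    C.ext fun w => by
      have := C.lift (C.ext (a := C.S C.p * C.R) (b := C.si * C.S C.si * C.p * C.s)
        fun w => by simpa using C.p_R_eq w) 1 w
      simpa only [act_mul, act_S, zero_add, Nat.reduceAdd] using this
  have hR1 := C.lift hR 0
  simp only [act_mul, act_S, zero_add, Nat.reduceAdd] at hR1
  have h := C.m_s_p_si_y w
  rw [← C.p_R_eq w, hm] at h
  have h' : 𝐦 0 (𝐫 2 (𝐩 1 (𝐬 1 (𝐩 0 w)))) = 𝐬 0 (𝐦 1 (𝐫 0 (𝐩 2 (𝐑 1 (𝐩 0 w))))) := by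
    rw [hR1, ← hm, act_s_si]
  rw [h'] at h
  replace h := congrArg (𝐫 0) h
  rw [act_si_s, act_si_s] at h
  have h2 : 𝐦 1 (𝐩 2 (𝐫 0 (𝐩 0 (𝐑 0 w)))) = 𝐦 1 (𝐩 2 (𝐫 0 (𝐑 1 (𝐩 0 w)))) := by
    simpa using h
  replace h2 := congrArg (fun v => 𝐬 0 (𝐦 1 (𝐤 2 (𝐩 2 v)))) h2
  simp only [hc, act_s_si] at h2
  simpa using h2

theorem Sp_R : C.S C.p * C.R = C.R * C.S C.p := C.ext fun w => by
  have hm (v : E) : 𝐦 2 (𝐬 1 v) = 𝐬 1 (𝐦 1 (𝐫 2 v)) := by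
    have := C.lift C.s_m 1 (𝐫 2 v)
    simp only [act_mul, act_S, Nat.reduceAdd, act_s_si] at this
    exact this.symm
  have hc (v : E) : 𝐦 1 (𝐤 1 (𝐩 0 (𝐦 1 (𝐩 0 v)))) = v := by
    simpa only [act_mul, act_S, act_one] using C.lift C.left_can_left_inv 0 v
  have h := C.m_s_p_si_x w
  rw [← C.p_R_eq' w, hm] at h
  have h' : 𝐦 2 (𝐫 0 (𝐩 1 (𝐬 0 (𝐩 1 w)))) = 𝐬 1 (𝐦 1 (𝐫 2 (𝐩 0 (𝐑 0 (𝐩 1 w))))) := by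
    rw [p_R_eq', ← hm, act_s_si]
  rw [h'] at h
  replace h := congrArg (𝐫 1) h
  rw [act_si_s, act_si_s] at h
  have h2 : 𝐦 1 (𝐩 0 (𝐫 1 (𝐩 1 (𝐑 0 w)))) = 𝐦 1 (𝐩 0 (𝐫 1 (𝐑 0 (𝐩 1 w)))) := by
    simpa using h
  replace h2 := congrArg (fun v => 𝐬 1 (𝐦 1 (𝐤 1 (𝐩 0 v)))) h2
  simp only [hc, act_s_si] at h2
  simpa using h2

theorem act_p_R (k : ℕ) (w : E) : 𝐩 k (𝐑 k w) = 𝐑 (k + 1) (𝐩 k w) := by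
  simpa using C.lift C.p_R k w

theorem act_Sp_R (k : ℕ) (w : E) : 𝐩 (k + 1) (𝐑 k w) = 𝐑 k (𝐩 (k + 1) w) := by
  simpa using C.lift C.Sp_R k w

theorem p_s : C.p * C.s = C.S C.s * C.t * C.S C.p := C.ext fun w => by
  simp only [act_mul, act_S, zero_add]
  rw [← act_s_R, ← C.act_Sp_R 0, p_R_eq, act_s_si, act_s_si]

theorem Sp_s : C.S C.p * C.s = C.s * C.S C.t * C.p := C.ext fun w => by
  simp only [act_mul, act_S, zero_add]
  rw [← act_s_R, ← C.act_p_R 0, p_R_eq', act_s_si, act_s_si]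

/-! ### Invertibility of `σ⁻¹ τ` -/

/-- The inverse of `σ⁻¹ τ`. -/
def V : E := C.S (C.S C.e) * C.S C.s * C.p

local notation "𝐕" => C.act C.V

theorem act_V (k : ℕ) (w : E) : 𝐕 k w = 𝐞 (k + 2) (𝐬 (k + 1) (𝐩 k w)) := by
  simp [V]

theorem V_far {k a : ℕ} (h w : E) (hk : k + 2 ≤ a) :
    𝐕 k (C.act h a w) = C.act h a (𝐕 k w) := by
  rw [act_V, act_V, p_far, s_far, e_far, Nat.add_sub_cancel] <;> omega

attribute [local simp] V_far

theorem V_R : C.V * C.R = 1 := C.ext fun w => by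
  simp only [act_mul, act_one, act_V, zero_add]
  rw [p_R_eq', act_s_si]
  calc _ = 𝐫 0 (𝐞 2 (𝐩 1 (𝐬 0 w))) := by simp
    _ = w := by rw [C.act_Se_p 1, act_si_s]

theorem p_V : C.p * C.V = C.S C.V * C.p := C.ext fun w => by
  have := C.act_p_p 0 w
  simp_all [act_V]

theorem e_R (w : E) : 𝐞 0 (𝐑 0 w) = 𝐞 0 (𝐦 0 (𝐩 1 w)) := by
  have h1 := C.lift (C.ext (a := C.S C.e * C.t) (b := C.e) fun w => by simpa using C.Se_t w) 1
  have h2 := C.lift C.p_s 1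
  simp only [act_mul, act_S, Nat.reduceAdd] at h1 h2
  calc _ = 𝐞 0 (𝐫 0 (𝐞 0 (𝐦 0 (𝐩 1 (𝐬 1 (𝐩 0 w)))))) := by rw [act_R, t_eq_q_p_s_p]
    _ = 𝐞 0 (𝐞 0 (𝐦 0 (𝐫 2 (𝐩 1 (𝐬 1 (𝐩 0 w)))))) := by simp
    _ = 𝐞 0 (𝐞 0 (𝐦 0 (𝐭 1 (𝐩 2 (𝐩 0 w))))) := by rw [h2, act_si_s]
    _ = 𝐞 0 (𝐦 0 (𝐞 2 (𝐭 1 (𝐩 2 (𝐩 0 w))))) := by simp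
    _ = 𝐞 0 (𝐦 0 (𝐩 1 (𝐞 1 (𝐩 0 w)))) := by rw [h1]; simp
    _ = _ := by rw [C.act_Se_p 0]

/-- A left colinear map is determined by its composite with `ε ⊗ id`. Both `R` and `V` are left
colinear, so only that composite needs checking. -/
theorem R_V : C.R * C.V = 1 := C.ext fun w => by
  have h1 (w : E) : 𝐞 0 (𝐑 0 (𝐕 0 w)) = 𝐞 0 w := by
    rw [e_R, ← C.Se_t w, t_eq_q_p_s_p]
    simp [act_V]
  have h2 := C.lift (C.ext (a := C.e * C.R * C.V) (b := C.e) fun w => by simpa using h1 w) 1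
  have h3 := C.lift C.p_V 0
  simp only [act_mul, act_S, act_one, zero_add] at *
  rw [← C.act_Se_p 0 (𝐑 0 (𝐕 0 w)), act_p_R, h3, h2, C.act_Se_p 0]

theorem act_V_R (k : ℕ) (w : E) : 𝐕 k (𝐑 k w) = w := by
  simpa using C.lift C.V_R k w

theorem act_R_V (k : ℕ) (w : E) : 𝐑 k (𝐕 k w) = w := by
  simpa using C.lift C.R_V k w

theorem act_t_V (k : ℕ) (w : E) : 𝐭 k (𝐕 k w) = 𝐬 k w := by
  rw [← act_s_R, act_R_V]

theorem Sp_V (w : E) : 𝐩 1 (𝐕 0 w) = 𝐕 0 (𝐩 1 w) := by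
  rw [← C.act_V_R 0 (𝐩 1 (𝐕 0 w)), ← C.act_Sp_R 0, act_R_V]

/-! ### Hexagons and coproduct laws for `τ` and `σ τ⁻¹ σ` -/

theorem T_m (w : E) : 𝐓 0 (𝐦 0 w) = 𝐦 0 (𝐭 1 (𝐓 0 (𝐫 1 w))) := by
  have h1 := C.lift C.s_Sm 0
  have h2 := C.lift C.Sp_s 1
  simp only [act_mul, act_S, zero_add, Nat.reduceAdd] at h1 h2
  have h3 (v : E) : 𝐫 0 (𝐦 0 v) = 𝐦 1 (𝐫 0 (𝐫 1 v)) := by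
    rw [← C.act_si_s 0 (𝐦 1 (𝐫 0 (𝐫 1 v))), h1, act_s_si, act_s_si]
  have h4 (v : E) : 𝐫 1 (𝐩 2 v) = 𝐭 2 (𝐩 1 (𝐫 1 v)) := by
    rw [← C.act_si_s 1 (𝐭 2 (𝐩 1 (𝐫 1 v))), ← h2, act_s_si]
  calc _ = 𝐞 0 (𝐫 0 (𝐦 0 (𝐩 2 w))) := by simp [act_T']
    _ = 𝐞 0 (𝐦 1 (𝐫 0 (𝐭 2 (𝐩 1 (𝐫 1 w))))) := by rw [h3, h4]
    _ = _ := by simp [act_T']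

theorem t_Sm : C.t * C.S C.m = C.m * C.S C.t * C.t := C.ext fun w => by
  have h1 := C.lift C.s_Sm 0
  simp only [act_mul, act_S, zero_add] at *
  rw [act_t, h1, T_m, act_si_s, ← act_t]

theorem T_s_V (w : E) : 𝐓 0 (𝐬 0 (𝐕 0 w)) = 𝐬 0 w := by
  rw [← act_t, act_t_V]

theorem T_injective {v w : E} (h : 𝐓 0 v = 𝐓 0 w) : v = w := by
  have key (v : E) : 𝐬 0 (𝐕 0 (𝐫 0 (𝐓 0 v))) = v := by
    rw [← C.act_s_si 0 v, ← act_t, ← act_R, act_V_R]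
  rw [← key v, h, key]

/-- Here `σ V = σ τ⁻¹ σ`. As `T` is injective and `T σ V = σ`, the hexagon may be tested after `T`,
where it reduces to that of `σ`. -/
theorem s_V_Sm : C.s * C.V * C.S C.m = C.m * C.S (C.s * C.V) * (C.s * C.V) :=
    C.ext fun w => C.T_injective <| by
  have h1 := C.lift C.s_Sm 0
  simp only [act_mul, act_S, zero_add] at *
  have h2 (v : E) : 𝐓 0 (𝐕 1 v) = 𝐕 1 (𝐓 0 v) := by
    rw [act_V, act_V, C.act_Sp_T 0]
    simp
  rw [T_s_V, h1, T_m, act_si_s, h2, act_t_V, T_s_V]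

theorem p_t : C.p * C.t = C.S C.t * C.t * C.S C.p := C.ext fun w => by
  have h := C.lift C.p_s 0
  simp only [act_mul, act_S, zero_add] at *
  rw [act_t, act_p_T, h, C.act_t 1]

theorem p_s_V : C.p * (C.s * C.V) = C.S C.s * C.s * C.S C.p := C.ext fun w => by
  have h := C.lift C.p_s 0
  simp only [act_mul, act_S, zero_add] at *
  rw [h, Sp_V, act_t_V]

theorem p_s' : C.p * C.s = C.S C.t * C.s * C.S C.p := C.ext fun w => by
  have h := C.lift C.p_s_V 0
  simp only [act_mul, act_S, zero_add] at *
  rw [act_t, ← h, ← act_p_T, T_s_V]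

/-! ### Sliding a strand through a crossing -/

/-- `g` acts on the two leading factors only. -/
def IsBinary (g : E) : Prop := ∀ h, g * C.S (C.S h) = C.S (C.S h) * g

variable {C}

theorem IsBinary.far {g : E} (hg : C.IsBinary g) {k a : ℕ} (h w : E) (hk : k + 2 ≤ a) :
    C.act g k (C.act h a w) = C.act h a (C.act g k w) := by
  obtain ⟨n, rfl⟩ := Nat.exists_eq_add_of_le hk
  exact C.iterate_comm (i := 2) (j := 2) hg k n h w

theorem IsBinary.mul {a b : E} (ha : C.IsBinary a) (hb : C.IsBinary b) : C.IsBinary (a * b) :=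
  fun h => by rw [mul_assoc, hb h, ← mul_assoc, ha h, mul_assoc]

theorem isBinary_s : C.IsBinary C.s := C.s_nat

theorem isBinary_t : C.IsBinary C.t := fun h => C.ext fun w => by simp

theorem isBinary_V : C.IsBinary C.V := fun h => C.ext fun w => by simp

/-- Write `1 ⊗ x = a(y)`, insert a second unit by `m (id ⊗ 1) = id`, and apply the hexagon: the
result is `1 · a(x ⊗ 1)`. -/
theorem Su_of_hexagon {a a' : E} (ha : C.IsBinary a) (haa : a * a' = 1)
    (ham : a * C.S C.m = C.m * C.S a * a) : a * C.S C.u = C.u := C.ext fun w => by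
  have h1 := C.lift ham 0
  have h2 := C.lift C.m_Su 1
  have h3 := C.lift haa 0
  have h4 := C.lift C.m_u 0
  simp only [act_mul, act_S, act_one, zero_add, Nat.reduceAdd] at *
  symm
  calc _ = C.act a 0 (𝐦 1 (𝐮 2 (C.act a' 0 (𝐮 0 w)))) := by rw [h2, h3]
    _ = 𝐦 0 (C.act a 1 (𝐮 2 (𝐮 0 w))) := by
      rw [h1, ha.far (k := 0) (a := 2) _ _ le_rfl, h3]
    _ = 𝐦 0 (𝐮 0 (C.act a 0 (𝐮 1 w))) := by simp
    _ = _ := by rw [h4]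

/-- The hexagon and associativity show that both sides agree after `a` preceded by a canonical map.
Inverting that map and evaluating `a` at the unit isolates `F`. -/
theorem cancel_left {a F F' : E} (ha : C.IsBinary a) (ham : a * C.S C.m = C.m * C.S a * a)
    (hau : a * C.S C.u = C.u) (h : C.m * C.S F * a * C.S C.p = C.m * C.S F' * a * C.S C.p) :
    F = F' := by
  have key {F F' : E} (h : C.m * C.S F * a * C.S C.p = C.m * C.S F' * a * C.S C.p) (w : E) :
      𝐦 0 (C.act F 1 (C.act a 0 (𝐦 1 (𝐩 2 w)))) = 𝐦 0 (C.act F' 1 (C.act a 0 (𝐦 1 (𝐩 2 w)))) := by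
    have h1 := C.lift ham 0
    have h2 := C.lift C.m_assoc 0
    have h3 := C.lift h 1
    simp only [act_mul, act_S, zero_add, Nat.reduceAdd] at *
    have step (F : E) : 𝐦 0 (C.act F 1 (C.act a 0 (𝐦 1 (𝐩 2 w)))) =
        𝐦 0 (𝐦 1 (C.act F 2 (C.act a 1 (𝐩 2 (C.act a 0 w))))) := by
      rw [← h2, h1, ha.far (k := 0) (a := 2) _ _ le_rfl]
      simp
    rw [step, step, h3]
  have h4 := C.lift C.right_can_right_inv 1
  have h5 := C.lift hau 0
  have h6 := C.lift C.m_u 0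
  simp only [act_mul, act_S, act_one, zero_add, Nat.reduceAdd] at *
  refine C.ext fun w => ?_
  have h7 := key h (𝐦 1 (𝐤 2 (𝐩 2 (𝐮 1 w))))
  have step (F : E) : 𝐦 0 (C.act F 1 (𝐮 0 w)) = C.act F 0 w := by
    rw [← h6 (C.act F 0 w)]
    simp
  rwa [h4, h5, step, step] at h7

theorem cancel_right {b D D' : E} (hbm : b * C.S C.m = C.m * C.S b * b)
    (hbu : b * C.S C.u = C.u)
    (hD : ∀ h, D * C.S (C.S (C.S h)) = C.S (C.S (C.S h)) * D)
    (hD' : ∀ h, D' * C.S (C.S (C.S h)) = C.S (C.S (C.S h)) * D')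
    (h : C.S C.m * C.S (C.S b) * D * C.S (C.S C.p) =
      C.S C.m * C.S (C.S b) * D' * C.S (C.S C.p)) : D = D' := by
  have h1 := C.lift hbm 2
  have h2 := C.lift C.m_assoc 1
  have h3 := C.lift h 0
  have h4 := C.lift C.left_can_right_inv 2
  have h5 := C.lift hbu 2
  have h6 := C.lift C.m_Su 1
  simp only [act_mul, act_S, act_one, zero_add, Nat.reduceAdd] at *
  have step {D : E} (hD : ∀ h, D * C.S (C.S (C.S h)) = C.S (C.S (C.S h)) * D) (w : E) :
      𝐦 1 (C.act b 2 (C.act D 0 (𝐦 3 (𝐩 2 w)))) =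
        𝐦 1 (C.act b 2 (𝐦 1 (C.act b 2 (C.act D 0 (𝐩 2 w))))) := by
    have h7 := C.lift (hD C.m) 0
    simp only [act_mul, act_S, zero_add, Nat.reduceAdd] at h7
    rw [h7, h1, ← h2]
    simp
  have step' {D : E} (hD : ∀ h, D * C.S (C.S (C.S h)) = C.S (C.S (C.S h)) * D) (w : E) :
      𝐦 1 (C.act b 2 (C.act D 0 (𝐮 3 w))) = C.act D 0 w := by
    have h7 := C.lift (hD C.u) 0
    simp only [act_mul, act_S, zero_add, Nat.reduceAdd] at h7
    rw [h7, h5, h6]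
  refine C.ext fun w => ?_
  rw [← step' hD, ← step' hD', ← h4 (𝐮 3 w), step hD, step hD', h3]

/-- A strand crossing two strands by `a` and `b` can be moved through the crossing `σ` of the
latter two. -/
theorem strand_s {a b c : E} (ha : C.IsBinary a) (hb : C.IsBinary b) (hc : C.IsBinary c)
    (ham : a * C.S C.m = C.m * C.S a * a) (hbm : b * C.S C.m = C.m * C.S b * b)
    (hcm : c * C.S C.m = C.m * C.S c * c) (hau : a * C.S C.u = C.u) (hbu : b * C.S C.u = C.u)
    (hpc : C.p * c = C.S b * a * C.S C.p) : C.s * C.S a * b = C.S b * a * C.S C.s := by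
  have ha_far := fun k l => @IsBinary.far _ _ _ _ ha k l
  have hb_far := fun k l => @IsBinary.far _ _ _ _ hb k l
  have hc_far := fun k l => @IsBinary.far _ _ _ _ hc k l
  have h1 := C.lift ham 0
  have h2 := C.lift hbm 2
  have h3 := C.lift hcm 0
  have h4 := C.lift hpc 0
  have h4' := C.lift hpc 1
  have h5 := C.lift C.p_m 0
  have h5' := C.lift C.p_m 1
  refine cancel_right hbm hbu ?_ ?_ (cancel_left ha ham hau ?_)
  · exact fun h => C.ext fun w => by simp [ha_far, hb_far]
  · exact fun h => C.ext fun w => by simp [ha_far, hb_far]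
  refine C.ext fun w => ?_
  simp only [act_mul, act_S, zero_add, Nat.reduceAdd] at *
  symm
  calc _ = 𝐦 0 (𝐦 2 (C.act b 3 (C.act b 2 (C.act a 1 (C.act a 0 (𝐬 2 (𝐩 1 (𝐩 2 w)))))))) := by
        simp [ha_far]
    _ = 𝐦 0 (C.act b 2 (𝐦 3 (C.act a 1 (C.act a 0 (𝐬 2 (𝐩 1 (𝐩 2 w))))))) := by rw [h2]
    _ = C.act b 1 (𝐦 0 (C.act a 1 (C.act a 0 (𝐦 3 (𝐬 2 (𝐩 1 (𝐩 2 w))))))) := by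
        simp [ha_far]
    -- The pivot: above it `φ` passes `c` before meeting `m`; below it `m` passes `c` before meeting
    -- `φ`.
    _ = 𝐩 0 (C.act c 0 (𝐦 1 w)) := by rw [h4, h5', h1]
    _ = 𝐦 0 (𝐦 2 (𝐬 1 (𝐩 0 (C.act b 2 (C.act a 1 (𝐩 2 (C.act c 0 w))))))) := by
        rw [h3, h5, h4']
    _ = 𝐦 0 (𝐦 2 (𝐬 1 (C.act b 3 (C.act a 2 (𝐩 0 (C.act c 0 (𝐩 2 w))))))) := by simp [hc_far]
    _ = 𝐦 0 (𝐦 2 (𝐬 1 (C.act b 3 (C.act a 2 (C.act b 1 (C.act a 0 (𝐩 1 (𝐩 2 w)))))))) := by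
        rw [h4]
    _ = _ := by simp [ha_far, hb_far]

/-- The strand passes `φ` at the cost of an extra `τ`, which `hbt` carries past `σ⁻¹` and `ε`
absorbs by `e_t`. -/
theorem strand_T {b g : E} (hb : C.IsBinary b) (hg : C.IsBinary g)
    (hpg : C.p * g = C.S C.t * g * C.S C.p) (hbt : C.s * C.S C.t * b = C.S b * C.t * C.S C.s) :
    C.T * C.S b * g = C.S b * g * C.S C.T := C.ext fun w => by
  have hb_far := fun k l => @IsBinary.far _ _ _ _ hb k l
  have hg_far := fun k l => @IsBinary.far _ _ _ _ hg k l
  have h1 := C.lift hpg 0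
  have h2 := C.lift hbt 1
  have h3 := C.lift (C.ext (a := C.e * C.t) (b := C.S C.e) fun w => by simpa using C.e_t w) 2
  simp only [act_mul, act_S, zero_add, Nat.reduceAdd] at *
  have h4 (v : E) : 𝐫 1 (C.act b 2 (𝐭 1 v)) = 𝐭 2 (C.act b 1 (𝐫 2 v)) := by
    rw [← C.act_si_s 1 (𝐭 2 (C.act b 1 (𝐫 2 v))), h2, act_s_si]
  calc _ = 𝐞 2 (𝐫 1 (C.act b 2 (𝐩 0 (C.act g 0 w)))) := by simp [act_T]
    _ = 𝐞 3 (C.act b 1 (𝐫 2 (C.act g 0 (𝐩 1 w)))) := by rw [h1, h4, h3]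
    _ = _ := by simp [act_T, hb_far, hg_far]

theorem strand_t {b g : E} (hb : C.IsBinary b) (hg : C.IsBinary g)
    (hpb : C.p * b = C.S C.t * b * C.S C.p) (hgt : C.s * C.S C.t * g = C.S g * C.t * C.S C.s)
    (h : C.s * C.S b * g = C.S g * b * C.S C.s) :
    C.t * C.S b * g = C.S g * b * C.S C.t := by
  have := strand_T hg hb hpb hgt
  calc _ = C.T * (C.s * C.S b * g) := by simp only [t, mul_assoc]
    _ = C.T * C.S g * b * C.S C.s := by rw [h]; simp only [mul_assoc]
    _ = _ := by rw [this]; simp only [t, map_mul, mul_assoc]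

theorem t_right_inv : C.t * (C.V * C.si) = 1 := C.ext fun w => by
  simp [act_t_V, act_s_si]

theorem s_Su : C.s * C.S C.u = C.u := Su_of_hexagon isBinary_s C.s_si C.s_Sm

theorem t_Su : C.t * C.S C.u = C.u := Su_of_hexagon isBinary_t t_right_inv C.t_Sm

theorem braid_sss : C.s * C.S C.s * C.s = C.S C.s * C.s * C.S C.s :=
  strand_s isBinary_s isBinary_s (isBinary_s.mul isBinary_V) C.s_Sm C.s_Sm C.s_V_Sm s_Su s_Su
    C.p_s_V

theorem braid_sst : C.s * C.S C.s * C.t = C.S C.t * C.s * C.S C.s :=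
  strand_s isBinary_s isBinary_t isBinary_s C.s_Sm C.t_Sm C.s_Sm s_Su t_Su C.p_s'

theorem braid_sts : C.s * C.S C.t * C.s = C.S C.s * C.t * C.S C.s :=
  strand_s isBinary_t isBinary_s isBinary_s C.t_Sm C.s_Sm C.s_Sm t_Su s_Su C.p_s

theorem braid_stt : C.s * C.S C.t * C.t = C.S C.t * C.t * C.S C.s :=
  strand_s isBinary_t isBinary_t isBinary_t C.t_Sm C.t_Sm C.t_Sm t_Su t_Su C.p_t

theorem braid_tss : C.t * C.S C.s * C.s = C.S C.s * C.s * C.S C.t :=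
  strand_t isBinary_s isBinary_s C.p_s' braid_sts braid_sss

theorem braid_tst : C.t * C.S C.s * C.t = C.S C.t * C.s * C.S C.t :=
  strand_t isBinary_s isBinary_t C.p_s' braid_stt braid_sst

theorem braid_tts : C.t * C.S C.t * C.s = C.S C.s * C.t * C.S C.t :=
  strand_t isBinary_t isBinary_s C.p_t braid_sts braid_sts

theorem braid_ttt : C.t * C.S C.t * C.t = C.S C.t * C.t * C.S C.t :=
  strand_t isBinary_t isBinary_t C.p_t braid_stt braid_stt

end BraidedCalculus

/-! ### Operators on an absorbing space -/

open scoped TensorProduct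

noncomputable section

namespace BraidedQG

section Absorbing

variable {A : Type*} [Ring A] [Algebra ℂ A]
variable {M : Type*} [AddCommGroup M] [Module ℂ M] (c : A ⊗[ℂ] M ≃ₗ[ℂ] M)
variable {N P : Type*} [AddCommGroup N] [Module ℂ N] [AddCommGroup P] [Module ℂ P]

/-- Absorption of one more factor `A` into `M`. -/
def up (g : N →ₗ[ℂ] M) : A ⊗[ℂ] N →ₗ[ℂ] M := c.toLinearMap ∘ₗ g.lTensor A

/-- The map `a ↦ a ⊗ n` followed by the absorption of `A`. -/
def base (n : M) : A →ₗ[ℂ] M := c.toLinearMap ∘ₗ (TensorProduct.mk ℂ A M).flip n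

@[simp]
theorem up_tmul (g : N →ₗ[ℂ] M) (a : A) (x : N) : up c g (a ⊗ₜ x) = c (a ⊗ₜ g x) := rfl

@[simp]
theorem base_apply (n : M) (a : A) : base c n a = c (a ⊗ₜ n) := rfl

theorem up_comp (g : N →ₗ[ℂ] M) (f : P →ₗ[ℂ] N) : up c (g ∘ₗ f) = up c g ∘ₗ f.lTensor A := by
  simp [up, LinearMap.lTensor_comp, LinearMap.comp_assoc]

theorem up_up_assoc (g : N →ₗ[ℂ] M) (x : A ⊗[ℂ] A) (y : N) :
    up c (up c g) (TensorProduct.assoc ℂ A A N (x ⊗ₜ y)) = up c (base c (g y)) x := by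
  induction x with
  | zero => simp
  | add x y hx hy => simp [TensorProduct.add_tmul, hx, hy]
  | tmul a b => simp

variable {c} in
theorem end_ext {f g : M →ₗ[ℂ] P} (h : ∀ (a : A) (v : M), f (c (a ⊗ₜ v)) = g (c (a ⊗ₜ v))) :
    f = g := by
  have : f ∘ₗ c.toLinearMap = g ∘ₗ c.toLinearMap := TensorProduct.ext' h
  ext v
  simpa using LinearMap.congr_fun this (c.symm v)

variable {c} in
theorem end_ext₂ {f g : M →ₗ[ℂ] P}
    (h : ∀ (n : M) (x : A ⊗[ℂ] A), f (up c (base c n) x) = g (up c (base c n) x)) : f = g := by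
  refine end_ext (c := c) fun a v => ?_
  suffices f ∘ₗ c.toLinearMap ∘ₗ TensorProduct.mk ℂ A M a =
      g ∘ₗ c.toLinearMap ∘ₗ TensorProduct.mk ℂ A M a from LinearMap.congr_fun this v
  exact end_ext (c := c) fun b n => h n (a ⊗ₜ b)

variable {c} in
theorem end_ext₃ {f g : M →ₗ[ℂ] P}
    (h : ∀ (n : M) (x : A ⊗[ℂ] (A ⊗[ℂ] A)),
      f (up c (up c (base c n)) x) = g (up c (up c (base c n)) x)) : f = g := by
  refine end_ext (c := c) fun a v => ?_
  suffices f ∘ₗ c.toLinearMap ∘ₗ TensorProduct.mk ℂ A M a =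
      g ∘ₗ c.toLinearMap ∘ₗ TensorProduct.mk ℂ A M a from LinearMap.congr_fun this v
  exact end_ext₂ (c := c) fun n x => h n (a ⊗ₜ x)

/-- `g ↦ id ⊗ g` -/
def shift : Module.End ℂ M →* Module.End ℂ M where
  toFun g := c.toLinearMap ∘ₗ g.lTensor A ∘ₗ c.symm.toLinearMap
  map_one' := by ext v; simp [Module.End.one_eq_id]
  map_mul' f g := by ext v; simp [Module.End.mul_eq_comp, LinearMap.lTensor_comp]

@[simp]
theorem shift_apply (h : Module.End ℂ M) (a : A) (v : M) :
    shift c h (c (a ⊗ₜ v)) = c (a ⊗ₜ h v) := by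
  simp [shift]

theorem shift_up (h : Module.End ℂ M) (g : N →ₗ[ℂ] M) (x : A ⊗[ℂ] N) :
    shift c h (up c g x) = up c (h ∘ₗ g) x := by
  simp [shift, up, LinearMap.lTensor_comp]

/-- The absorption of two factors `A`. -/
def absorb₂ : A ⊗[ℂ] (A ⊗[ℂ] M) ≃ₗ[ℂ] M := (c.lTensor A).trans c

theorem absorb₂_symm_up_base (n : M) (x : A ⊗[ℂ] A) :
    (absorb₂ c).symm (up c (base c n) x) = TensorProduct.assoc ℂ A A M (x ⊗ₜ n) := by
  rw [LinearEquiv.symm_apply_eq]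
  induction x with
  | zero => simp
  | add x y hx hy => simp [TensorProduct.add_tmul, hx, hy]
  | tmul a b => simp [absorb₂]

theorem absorb₂_assoc (n : M) (x : A ⊗[ℂ] A) :
    absorb₂ c (TensorProduct.assoc ℂ A A M (x ⊗ₜ n)) = up c (base c n) x := by
  rw [← absorb₂_symm_up_base, LinearEquiv.apply_symm_apply]

/-- The action of a linear map of `A ⊗ A` on the two leading factors. -/
def crossing (f : A ⊗[ℂ] A →ₗ[ℂ] A ⊗[ℂ] A) : Module.End ℂ M :=
  (absorb₂ c).toLinearMap ∘ₗ tensorId M f ∘ₗ (absorb₂ c).symm.toLinearMap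

theorem crossing_base (f : A ⊗[ℂ] A →ₗ[ℂ] A ⊗[ℂ] A) (n : M) (x : A ⊗[ℂ] A) :
    crossing c f (up c (base c n) x) = up c (base c n) (f x) := by
  simp [crossing, tensorId, absorb₂_symm_up_base, absorb₂_assoc]

theorem crossing_up (f : A ⊗[ℂ] A →ₗ[ℂ] A ⊗[ℂ] A) (g : N →ₗ[ℂ] M) (x : A ⊗[ℂ] (A ⊗[ℂ] N)) :
    crossing c f (up c (up c g) x) = up c (up c g) (tensorId N f x) := by
  obtain ⟨x, rfl⟩ := (TensorProduct.assoc ℂ A A N).surjective x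
  induction x with
  | zero => simp
  | add x y hx hy => simp [hx, hy]
  | tmul x y => simp [up_up_assoc, crossing_base, tensorId]

theorem crossing_mul (f g : A ⊗[ℂ] A →ₗ[ℂ] A ⊗[ℂ] A) :
    crossing c f * crossing c g = crossing c (f ∘ₗ g) :=
  end_ext₂ (c := c) fun n x => by simp [crossing_base]

theorem crossing_id : crossing c (LinearMap.id : A ⊗[ℂ] A →ₗ[ℂ] A ⊗[ℂ] A) = 1 :=
  end_ext₂ (c := c) fun n x => by simp [crossing_base]

theorem shift_crossing_up (f : A ⊗[ℂ] A →ₗ[ℂ] A ⊗[ℂ] A) (n : M) (x : A ⊗[ℂ] (A ⊗[ℂ] A)) :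
    shift c (crossing c f) (up c (up c (base c n)) x) =
      up c (up c (base c n)) (idTensor f x) := by
  have : crossing c f ∘ₗ up c (base c n) = up c (base c n) ∘ₗ f :=
    LinearMap.ext (crossing_base c f n)
  rw [shift_up, this, up_comp]
  rfl

theorem crossing_nat (f : A ⊗[ℂ] A →ₗ[ℂ] A ⊗[ℂ] A) (h : Module.End ℂ M) :
    crossing c f * shift c (shift c h) = shift c (shift c h) * crossing c f :=
  end_ext₂ (c := c) fun n x => by
    have (x : A ⊗[ℂ] A) : shift c (shift c h) (up c (base c n) x) = up c (base c (h n)) x := by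
      rw [shift_up]
      congr 2
      ext a
      simp
    simp [this, crossing_base]

/-- The product acting on the two leading factors. -/
def mulOp : Module.End ℂ M :=
  c.toLinearMap ∘ₗ (LinearMap.mul' ℂ A).rTensor M ∘ₗ
    (TensorProduct.assoc ℂ A A M).symm.toLinearMap ∘ₗ (absorb₂ c).symm.toLinearMap

@[simp]
theorem mulOp_apply (a b : A) (v : M) : mulOp c (c (a ⊗ₜ c (b ⊗ₜ v))) = c ((a * b) ⊗ₜ v) := by
  simp [mulOp, absorb₂]

theorem mulOp_base (n : M) (x : A ⊗[ℂ] A) :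
    mulOp c (up c (base c n) x) = base c n (LinearMap.mul' ℂ A x) := by
  induction x with
  | zero => simp
  | add x y hx hy => rw [map_add, map_add, map_add, map_add, hx, hy]
  | tmul a b => simp

/-- The unit acting in front of all factors. -/
def unitOp : Module.End ℂ M := c.toLinearMap ∘ₗ TensorProduct.mk ℂ A M 1

@[simp]
theorem unitOp_apply (v : M) : unitOp c v = c ((1 : A) ⊗ₜ v) := rfl

/-- The action of a linear map of `A` on the leading factor. -/
def leading (f : A →ₗ[ℂ] A) : Module.End ℂ M :=
  c.toLinearMap ∘ₗ f.rTensor M ∘ₗ c.symm.toLinearMap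

@[simp]
theorem leading_apply (f : A →ₗ[ℂ] A) (a : A) (v : M) :
    leading c f (c (a ⊗ₜ v)) = c (f a ⊗ₜ v) := by
  simp [leading]

theorem shift_shift_crossing (f : A ⊗[ℂ] A →ₗ[ℂ] A ⊗[ℂ] A) (n : M)
    (x : A ⊗[ℂ] (A ⊗[ℂ] (A ⊗[ℂ] A))) :
    shift c (shift c (crossing c f)) (up c (up c (up c (base c n))) x) =
      up c (up c (up c (base c n))) ((idTensor f).lTensor A x) := by
  have : shift c (crossing c f) ∘ₗ up c (up c (base c n)) =
      up c (up c (base c n)) ∘ₗ idTensor f := LinearMap.ext (shift_crossing_up c f n)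
  rw [shift_up, this, up_comp]
  rfl

theorem mulOp_up_up (n : M) (x : A ⊗[ℂ] (A ⊗[ℂ] A)) :
    mulOp c (up c (up c (base c n)) x) = up c (base c n) (mulTensorId x) := by
  obtain ⟨x, rfl⟩ := (TensorProduct.assoc ℂ A A A).surjective x
  induction x with
  | zero => simp
  | add x y hx hy => simp [hx, hy]
  | tmul x y => simp [up_up_assoc, mulOp_base, mulTensorId]

theorem shift_mulOp_up_up (n : M) (x : A ⊗[ℂ] (A ⊗[ℂ] A)) :
    shift c (mulOp c) (up c (up c (base c n)) x) = up c (base c n) (idTensorMul x) := by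
  have : mulOp c ∘ₗ up c (base c n) = base c n ∘ₗ LinearMap.mul' ℂ A :=
    LinearMap.ext (mulOp_base c n)
  rw [shift_up, this, up_comp]
  rfl

theorem mulOp_shift_shift_mulOp (n : M) (x : (A ⊗[ℂ] A) ⊗[ℂ] (A ⊗[ℂ] A)) :
    mulOp c (shift c (shift c (mulOp c)) (up c (up c (up c (base c n)))
      (TensorProduct.assoc ℂ A A (A ⊗[ℂ] A) x))) =
    up c (base c n) (TensorProduct.map (LinearMap.mul' ℂ A) (LinearMap.mul' ℂ A) x) := by
  induction x with
  | zero => simp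
  | add x y hx hy => simp [hx, hy]
  | tmul x y =>
    induction x with
    | zero => simp
    | add x x' hx hy => simp only [TensorProduct.add_tmul, map_add, hx, hy]
    | tmul a b => simp [mulOp_base]

theorem shift_crossing_up_up (f : A ⊗[ℂ] A →ₗ[ℂ] A ⊗[ℂ] A) (n : M)
    (x : A ⊗[ℂ] (A ⊗[ℂ] (A ⊗[ℂ] A))) :
    shift c (crossing c f) (up c (up c (up c (base c n))) x) =
      up c (up c (up c (base c n))) ((tensorId A f).lTensor A x) := by
  have : crossing c f ∘ₗ up c (up c (base c n)) =
      up c (up c (base c n)) ∘ₗ tensorId A f := LinearMap.ext (crossing_up c f _)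
  rw [shift_up, this, up_comp]
  rfl

theorem leading_up (f : A →ₗ[ℂ] A) (g : N →ₗ[ℂ] M) (x : A ⊗[ℂ] N) :
    leading c f (up c g x) = up c g (f.rTensor N x) := by
  induction x with
  | zero => simp
  | add x y hx hy => simp [hx, hy]
  | tmul a y => simp

theorem shift_leading_up (f : A →ₗ[ℂ] A) (n : M) (x : A ⊗[ℂ] A) :
    shift c (leading c f) (up c (base c n) x) = up c (base c n) (f.lTensor A x) := by
  have : leading c f ∘ₗ base c n = base c n ∘ₗ f := by ext a; simp
  rw [shift_up, this, up_comp]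
  rfl

/-- A linear functional with value `1` at `n` recovers `a` from `a ⊗ n`. -/
theorem base_injective {n : M} (hn : n ≠ 0) : Function.Injective (base c n) := by
  obtain ⟨f, hf⟩ := Module.Projective.exists_dual_eq_one ℂ hn
  have h (a : A) : TensorProduct.rid ℂ A (f.lTensor A (c.symm (base c n a))) = a := by
    simp [hf]
  intro a b hab
  rw [← h a, hab, h]

theorem up_injective {g : N →ₗ[ℂ] M} (hg : Function.Injective g) :
    Function.Injective (up c g) :=
  c.injective.comp (Module.Flat.lTensor_preserves_injective_linearMap g hg)

/-- An identity of the operators on `M` is an identity of maps of `A ⊗ A ⊗ A`. -/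
theorem braid_of_crossing [Nontrivial M] {f₁ f₂ f₃ g₁ g₂ g₃ : A ⊗[ℂ] A →ₗ[ℂ] A ⊗[ℂ] A}
    (h : crossing c f₁ * shift c (crossing c f₂) * crossing c f₃ =
      shift c (crossing c g₁) * crossing c g₂ * shift c (crossing c g₃)) :
    tensorId A f₁ ∘ₗ idTensor f₂ ∘ₗ tensorId A f₃ =
      idTensor g₁ ∘ₗ tensorId A g₂ ∘ₗ idTensor g₃ := by
  obtain ⟨n, hn⟩ := exists_ne (0 : M)
  refine LinearMap.ext fun x => up_injective c (up_injective c (base_injective c hn)) ?_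
  have hx := LinearMap.congr_fun h (up c (up c (base c n)) x)
  simpa only [Module.End.mul_apply, crossing_up, shift_crossing_up, LinearMap.comp_apply] using hx

variable [Coalgebra ℂ A]

/-- The counit acting on the leading factor. -/
def counitOp : Module.End ℂ M :=
  (TensorProduct.lid ℂ M).toLinearMap ∘ₗ (Coalgebra.counit (R := ℂ) (A := A)).rTensor M ∘ₗ
    c.symm.toLinearMap

@[simp]
theorem counitOp_apply (a : A) (v : M) :
    counitOp c (c (a ⊗ₜ v)) = Coalgebra.counit (R := ℂ) a • v := by
  simp [counitOp]

/-- The coproduct acting on the leading factor. -/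
def comulOp : Module.End ℂ M :=
  (absorb₂ c).toLinearMap ∘ₗ (TensorProduct.assoc ℂ A A M).toLinearMap ∘ₗ
    (Coalgebra.comul (R := ℂ) (A := A)).rTensor M ∘ₗ c.symm.toLinearMap

@[simp]
theorem comulOp_apply (a : A) (v : M) :
    comulOp c (c (a ⊗ₜ v)) = up c (base c v) (Coalgebra.comul (R := ℂ) a) := by
  simp [comulOp, absorb₂_assoc]

theorem comulOp_up (g : N →ₗ[ℂ] M) (x : A ⊗[ℂ] N) :
    comulOp c (up c g x) = up c (up c g)
      (TensorProduct.assoc ℂ A A N ((Coalgebra.comul (R := ℂ) (A := A)).rTensor N x)) := by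
  induction x with
  | zero => simp
  | add x y hx hy => simp [hx, hy]
  | tmul a y => simp [up_up_assoc]

theorem counitOp_up (g : N →ₗ[ℂ] M) (x : A ⊗[ℂ] N) : counitOp c (up c g x) =
    g (TensorProduct.lid ℂ N ((Coalgebra.counit (R := ℂ) (A := A)).rTensor N x)) := by
  induction x with
  | zero => simp
  | add x y hx hy => simp [hx, hy]
  | tmul a y => simp

theorem shift_counitOp_up (n : M) (x : A ⊗[ℂ] A) : shift c (counitOp c) (up c (base c n) x) =
    base c n (TensorProduct.rid ℂ A ((Coalgebra.counit (R := ℂ) (A := A)).lTensor A x)) := by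
  induction x with
  | zero => simp
  | add x y hx hy => simp only [map_add, hx, hy]
  | tmul a b => simp

theorem shift_shift_counitOp_up (n : M) (x : A ⊗[ℂ] (A ⊗[ℂ] A)) :
    shift c (shift c (counitOp c)) (up c (up c (base c n)) x) =
      up c (base c n) (idIdTensorCounit x) := by
  have : shift c (counitOp c) ∘ₗ up c (base c n) = base c n ∘ₗ
      ((TensorProduct.rid ℂ A).toLinearMap ∘ₗ
        (Coalgebra.counit (R := ℂ) (A := A)).lTensor A) := LinearMap.ext (shift_counitOp_up c n)
  rw [shift_up, this, up_comp]
  rfl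

end Absorbing

/-! ### The calculus of a braided quantum group -/

section Calculus

variable {A : Type*} [Ring A] [Algebra ℂ A] [Coalgebra ℂ A]
variable {M : Type*} [AddCommGroup M] [Module ℂ M] (c : A ⊗[ℂ] M ≃ₗ[ℂ] M)

theorem shift_comulOp_up (n : M) (x : A ⊗[ℂ] A) :
    shift c (comulOp c) (up c (base c n) x) = up c (up c (base c n)) (idTensorComul x) := by
  have : comulOp c ∘ₗ base c n = up c (base c n) ∘ₗ Coalgebra.comul (R := ℂ) (A := A) := by
    ext a
    simp
  rw [shift_up, this, up_comp]
  rfl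

theorem comulOp_up_base (n : M) (x : A ⊗[ℂ] A) :
    comulOp c (up c (base c n) x) = up c (up c (base c n)) (comulTensorId x) :=
  comulOp_up c _ x

theorem shift_comulOp_up_up (n : M) (x : A ⊗[ℂ] (A ⊗[ℂ] A)) :
    shift c (comulOp c) (up c (up c (base c n)) x) =
      up c (up c (up c (base c n))) (comulTensorId.lTensor A x) := by
  have : comulOp c ∘ₗ up c (base c n) = up c (up c (base c n)) ∘ₗ comulTensorId :=
    LinearMap.ext (comulOp_up_base c n)
  rw [shift_up, this, up_comp]
  rfl

theorem comulOp_shift_comulOp (n : M) (x : A ⊗[ℂ] A) :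
    comulOp c (shift c (comulOp c) (up c (base c n) x)) =
      up c (up c (up c (base c n))) (TensorProduct.assoc ℂ A A (A ⊗[ℂ] A)
        (TensorProduct.map (Coalgebra.comul (R := ℂ)) (Coalgebra.comul (R := ℂ)) x)) := by
  rw [shift_comulOp_up, comulOp_up]
  congr 2
  rw [idTensorComul, ← LinearMap.comp_apply, LinearMap.rTensor_comp_lTensor]

variable (G : BraidedQuantumGroup A)

/-- The operators of a braided quantum group `A` acting on a space `M ≅ A ⊗ M`. -/
def calculus : BraidedCalculus (Module.End ℂ M) where
  S := shift c
  s := crossing c G.σ.toLinearMap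
  si := crossing c G.σ.symm.toLinearMap
  m := mulOp c
  p := comulOp c
  e := counitOp c
  k := leading c G.κ.toLinearMap
  u := unitOp c
  s_nat := crossing_nat c _
  si_nat := crossing_nat c _
  m_nat h := end_ext (c := c) fun a v => by
    suffices (mulOp c * shift c (shift c h)) ∘ₗ c.toLinearMap ∘ₗ TensorProduct.mk ℂ A M a =
      (shift c h * mulOp c) ∘ₗ c.toLinearMap ∘ₗ TensorProduct.mk ℂ A M a from
        LinearMap.congr_fun this v
    exact end_ext (c := c) fun b n => by simp
  p_nat h := end_ext (c := c) fun a v => by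
    simp only [Module.End.mul_apply, shift_apply, comulOp_apply, shift_up]
    congr 2
    ext b
    simp
  e_nat h := end_ext (c := c) fun a v => by simp
  k_nat h := end_ext (c := c) fun a v => by simp
  u_nat h := by ext v; simp
  si_s := by rw [crossing_mul, ← crossing_id c]; simp
  s_si := by rw [crossing_mul, ← crossing_id c]; simp
  m_assoc := end_ext₃ (c := c) fun n x => by
    simp only [Module.End.mul_apply, mulOp_up_up, shift_mulOp_up_up, mulOp_base]
    congr 1
    induction x with
    | zero => simp
    | add x y hx hy => simp only [map_add, hx, hy]
    | tmul a x =>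
      induction x with
      | zero => simp
      | add x y hx hy => simp only [TensorProduct.tmul_add, map_add, hx, hy]
      | tmul a b => simp [mulTensorId, idTensorMul, mul_assoc]
  m_u := end_ext (c := c) fun a v => by simp
  m_Su := end_ext (c := c) fun a v => by simp
  p_coassoc := end_ext (c := c) fun a v => by
    simp only [Module.End.mul_apply, comulOp_apply, comulOp_up_base, shift_comulOp_up]
    congr 1
    exact Coalgebra.coassoc_apply (R := ℂ) a
  e_p := end_ext (c := c) fun a v => by
    simp [counitOp_up]
  Se_p := end_ext (c := c) fun a v => by
    simp [shift_counitOp_up]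
  s_m := end_ext₃ (c := c) fun n x => by
    simp only [Module.End.mul_apply, mulOp_up_up, shift_mulOp_up_up, shift_crossing_up,
      crossing_up, crossing_base]
    exact congrArg _ (LinearMap.congr_fun G.flip_mul_left x)
  s_Sm := end_ext₃ (c := c) fun n x => by
    simp only [Module.End.mul_apply, mulOp_up_up, shift_mulOp_up_up, shift_crossing_up,
      crossing_up, crossing_base]
    exact congrArg _ (LinearMap.congr_fun G.flip_mul_right x)
  p_m := end_ext₂ (c := c) fun n x => by
    have h := LinearMap.congr_fun G.comul_mul x
    simp only [LinearMap.comp_apply] at h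
    simp only [Module.End.mul_apply, mulOp_base, base_apply, comulOp_apply, comulOp_shift_comulOp,
      shift_crossing_up_up, h]
    rw [← mulOp_shift_shift_mulOp]
    simp [idTensorTensorId]
  s_p := end_ext₂ (c := c) fun n x => by
    simp only [Module.End.mul_apply, shift_comulOp_up, comulOp_up_base, shift_crossing_up,
      crossing_up, shift_comulOp_up_up, shift_shift_crossing]
    exact congrArg _ (LinearMap.congr_fun G.flip_comul x)
  m_Sk_p := end_ext (c := c) fun a v => by
    have h := LinearMap.congr_fun G.mul_antipode_right a
    simp only [LinearMap.comp_apply] at h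
    simp only [Module.End.mul_apply, comulOp_apply, shift_leading_up, mulOp_base, h]
    simp [Algebra.algebraMap_eq_smul_one]
  m_k_p := end_ext (c := c) fun a v => by
    have h := LinearMap.congr_fun G.mul_antipode_left a
    simp only [LinearMap.comp_apply] at h
    simp only [Module.End.mul_apply, comulOp_apply, leading_up, mulOp_base, h]
    simp [Algebra.algebraMap_eq_smul_one]

theorem calculus_t : (calculus c G).t = crossing c G.τ :=
  end_ext₂ (c := c) fun n x => by
    change shift c (shift c (counitOp c)) (shift c (crossing c G.σ.symm.toLinearMap)
      (comulOp c (crossing c G.σ.toLinearMap (up c (base c n) x)))) = _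
    rw [crossing_base, comulOp_up_base, shift_crossing_up, shift_shift_counitOp_up, crossing_base]
    rfl

end Calculus

/-! ### Existence of an absorbing space and conclusion -/

/-- The sequence with first term `i` and remaining terms `f`. -/
def consEquiv (ι : Type*) : ι × (ℕ → ι) ≃ (ℕ → ι) where
  toFun x n := Nat.casesOn n x.1 x.2
  invFun f := (f 0, fun n => f (n + 1))
  left_inv _ := rfl
  right_inv f := by
    ext n
    cases n <;> rfl

/-- For a basis `b` of `A` indexed by `ι`, the space with basis the sequences in `ι` absorbs a
tensor factor `A`. -/
def absorb {A ι : Type*} [AddCommGroup A] [Module ℂ A] (b : Module.Basis ι ℂ A) :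
    A ⊗[ℂ] ((ℕ → ι) →₀ ℂ) ≃ₗ[ℂ] ((ℕ → ι) →₀ ℂ) :=
  (TensorProduct.congr b.repr (LinearEquiv.refl ℂ _)).trans
    ((finsuppTensorFinsupp' ℂ ι (ℕ → ι)).trans (Finsupp.domLCongr (consEquiv ι)))

end BraidedQG

end

open BraidedQG in
theorem mainTheorem1 {A : Type*} [Ring A] [Algebra ℂ A] [Coalgebra ℂ A]
    (G : BraidedQuantumGroup A) :
    (tensorId A G.σ.toLinearMap ∘ₗ idTensor G.σ.toLinearMap ∘ₗ tensorId A G.σ.toLinearMap =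
      idTensor G.σ.toLinearMap ∘ₗ tensorId A G.σ.toLinearMap ∘ₗ idTensor G.σ.toLinearMap) ∧
    (tensorId A G.τ ∘ₗ idTensor G.σ.toLinearMap ∘ₗ tensorId A G.σ.toLinearMap =
      idTensor G.σ.toLinearMap ∘ₗ tensorId A G.σ.toLinearMap ∘ₗ idTensor G.τ) ∧
    (tensorId A G.σ.toLinearMap ∘ₗ idTensor G.τ ∘ₗ tensorId A G.σ.toLinearMap =
      idTensor G.σ.toLinearMap ∘ₗ tensorId A G.τ ∘ₗ idTensor G.σ.toLinearMap) ∧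
    (tensorId A G.σ.toLinearMap ∘ₗ idTensor G.σ.toLinearMap ∘ₗ tensorId A G.τ =
      idTensor G.τ ∘ₗ tensorId A G.σ.toLinearMap ∘ₗ idTensor G.σ.toLinearMap) ∧
    (tensorId A G.τ ∘ₗ idTensor G.τ ∘ₗ tensorId A G.σ.toLinearMap =
      idTensor G.σ.toLinearMap ∘ₗ tensorId A G.τ ∘ₗ idTensor G.τ) ∧
    (tensorId A G.τ ∘ₗ idTensor G.σ.toLinearMap ∘ₗ tensorId A G.τ =
      idTensor G.τ ∘ₗ tensorId A G.σ.toLinearMap ∘ₗ idTensor G.τ) ∧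
    (tensorId A G.σ.toLinearMap ∘ₗ idTensor G.τ ∘ₗ tensorId A G.τ =
      idTensor G.τ ∘ₗ tensorId A G.τ ∘ₗ idTensor G.σ.toLinearMap) ∧
    (tensorId A G.τ ∘ₗ idTensor G.τ ∘ₗ tensorId A G.τ =
      idTensor G.τ ∘ₗ tensorId A G.τ ∘ₗ idTensor G.τ) := by
  -- For `A = 0` the basis is empty and the absorbing space vanishes, so it cannot detect anything.
  rcases subsingleton_or_nontrivial A with hA | hA
  · have : Subsingleton (A ⊗[ℂ] (A ⊗[ℂ] A)) := inferInstance
    exact ⟨Subsingleton.elim _ _, Subsingleton.elim _ _, Subsingleton.elim _ _,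
      Subsingleton.elim _ _, Subsingleton.elim _ _, Subsingleton.elim _ _,
      Subsingleton.elim _ _, Subsingleton.elim _ _⟩
  have b := Module.Free.chooseBasis ℂ A
  have := b.index_nonempty
  have c := absorb b
  have ht := calculus_t c G
  refine ⟨braid_of_crossing c ?_, braid_of_crossing c ?_, braid_of_crossing c ?_,
    braid_of_crossing c ?_, braid_of_crossing c ?_, braid_of_crossing c ?_,
    braid_of_crossing c ?_, braid_of_crossing c ?_⟩ <;> try simp only [← ht]
  · exact BraidedCalculus.braid_sss (C := calculus c G)
  · exact BraidedCalculus.braid_tss (C := calculus c G)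
  · exact BraidedCalculus.braid_sts (C := calculus c G)
  · exact BraidedCalculus.braid_sst (C := calculus c G)
  · exact BraidedCalculus.braid_tts (C := calculus c G)
  · exact BraidedCalculus.braid_tst (C := calculus c G)
  · exact BraidedCalculus.braid_stt (C := calculus c G)
  · exact BraidedCalculus.braid_ttt (C := calculus c G)
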